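/- **Setting.** Let $n\ge 1$. The space $\mathbb{A}^{n,\mathrm{an}}_{\mathbb{Z}}$ is the set of multiplicative seminorms $|\cdot|_x$ on $\mathbb{Z}[T_1,\dots,T_n]$ with $|m|_x\le |m|_\infty$ for $m\in\mathbb{Z}$, endowed with the coarsest topology making $x\mapsto |P|_x$ continuous for all polynomials $P$. For a point $x$, $\mathcal{H}(x)$ is the completion of $\mathrm{Frac}(\mathbb{Z}[\underline T]/\ker|\cdot|_x)$. For $V$ open, $\mathcal{O}(V)$ is the ring of functions $f$ on $V$ with $f(x)\in\mathcal{H}(x)$ that are, near each point of $V$, uniform limits of quotients $P/Q$ of polynomials with $Q$ nowhere vanishing there. For a complete valued field $(k,|\cdot|)$, $a\in k$ and $r>0$, write $D(a,r)=\{|T-a|\le r\}$ and $D^\circ(a,r)=\{|T-a|<r\}$ in the Berkovich line $\mathbb{P}^{1,\mathrm{an}}_k$. We say that $D(\alpha,R)$ and $D(\beta,r)$ *cut out an annulus* $A$ if one of the following holds: * $D(\beta,r)\subseteq D^\circ(\alpha,R)$ and $A=D(\alpha,R)\setminus D(\beta,r)$; * $D(\alpha,R)\subseteq D^\circ(\beta,r)$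 and $A=D(\beta,r)\setminus D(\alpha,R)$; * the two disks are disjoint and $A=D(\alpha,R)^c\setminus D(\beta,r)$. The modulus $\mathrm{mod}_k A$ is defined as follows. * If $k$ is Archimedean, so that $k$ is $\mathbb{R}$ or $\mathbb{C}$ with $|\cdot|=|\cdot|_\infty^{\varepsilon}$ for some $\varepsilon\in(0,1]$, then $\mathrm{mod}_k A=\varepsilon\,\mathrm{mod}_{\mathbb{C}}(A_\varepsilon)$. Here $A_\varepsilon\subseteq\mathbb{P}^1(\mathbb{C})$ is the preimage of $A$ under the natural map $\mathbb{P}^1(\mathbb{C})\to\mathbb{P}^{1,\mathrm{an}}_k$, and $\mathrm{mod}_{\mathbb{C}}$ is the conformal modulus: $\mathrm{mod}_{\mathbb{C}}(B)=m$ if the interior of $B$ is conformally equivalent to $\{1<|z|<e^m\}$. * If $k$ is non-Archimedean, then $\mathrm{mod}_k A=\rho_k(\eta_{\alpha,R},\eta_{\beta,r})$ is the distance, in the Berkovich tree, between the boundary points of the two disks. It equals $|\log(R/r)|$ if $|\alpha-\beta|\le\max(R,r)$, and $\left|\log\frac{|\alpha-\beta|}{R}\right|+\left|\log\frac{|\alpha-\beta|}{r}\right|$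 otherwise. **Proposition.** Let $V\subseteq\mathbb{A}^{n,\mathrm{an}}_{\mathbb{Z}}$ be open, let $\alpha,\beta\in\mathcal{O}(V)$, and let $R,r:V\to\mathbb{R}_{>0}$ be continuous functions such that for every $x\in V$ the disks $D(\alpha(x),R(x))$ and $D(\beta(x),r(x))$ cut out an annulus $A_x$ in $\mathbb{P}^{1,\mathrm{an}}_{\mathcal{H}(x)}$. Then the function $V\to\mathbb{R}_{\ge 0}$, $x\mapsto\mathrm{mod}_{\mathcal{H}(x)}A_x$, is continuous. In particular, if $x_0\in V$ is non-Archimedean and $x\in V$ tends to $x_0$ through Archimedean points, with $|\cdot|_{\mathcal{H}(x)}=|\cdot|_\infty^{\varepsilon(x)}$, then $$\varepsilon(x)\,\mathrm{mod}_{\mathbb{C}}(A_{x,\varepsilon(x)})\longrightarrow \rho_{\mathcal{H}(x_0)}\big(\eta_{\alpha(x_0),R(x_0)},\eta_{\beta(x_0),r(x_0)}\big).$$ -/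

import Mathlib

open Set Filter Topology

noncomputable section

/-! ## Multiplicative seminorms and completed residue fields -/

section Residue

variable {A : Type*} [CommRing A]

/-- The kernel of a multiplicative seminorm. -/
def seminormKer (x : MulRingSeminorm A) : Ideal A where
  carrier := {a | x a = 0}
  zero_mem' := map_zero x
  add_mem' := by
    intro a b ha hb
    have h1 : x a = 0 := ha
    have h2 : x b = 0 := hb
    have h3 := map_add_le_add x a b
    exact le_antisymm (by linarith) (apply_nonneg x _)
  smul_mem' := by
    intro c a ha
    have h1 : x a = 0 := ha
    change x (c * a) = 0
    rw [map_mul, h1, mul_zero]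

theorem mem_seminormKer {x : MulRingSeminorm A} {a : A} : a ∈ seminormKer x ↔ x a = 0 := Iff.rfl

instance seminormKer_isPrime (x : MulRingSeminorm A) : (seminormKer x).IsPrime where
  ne_top' := by
    intro h
    have h1 : x 1 = 0 := by
      have : (1 : A) ∈ seminormKer x := by rw [h]; trivial
      exact this
    rw [map_one] at h1
    exact one_ne_zero h1
  mem_or_mem' := by
    intro a b h
    have h1 : x (a * b) = 0 := h
    rw [map_mul] at h1
    exact mul_eq_zero.mp h1

theorem seminorm_eq_of_sub_mem (x : MulRingSeminorm A) {a b : A} (h : a - b ∈ seminormKer x) :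
    x a = x b := by
  have h0 : x (a - b) = 0 := h
  have h1 := map_add_le_add x (a - b) b
  have h2 := map_add_le_add x (b - a) a
  have h3 : x (b - a) = 0 := by rw [map_sub_rev, h0]
  rw [sub_add_cancel] at h1 h2
  linarith

/-- The absolute value induced by a multiplicative seminorm on the quotient by its kernel. -/
def quotientAbs (x : MulRingSeminorm A) : AbsoluteValue (A ⧸ seminormKer x) ℝ where
  toFun := Quotient.lift (fun a => x a) fun _ _ h =>
    seminorm_eq_of_sub_mem x ((Submodule.quotientRel_def _).mp h)
  map_mul' := by
    intro a b
    obtain ⟨a, rfl⟩ := Ideal.Quotient.mk_surjective a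
    obtain ⟨b, rfl⟩ := Ideal.Quotient.mk_surjective b
    exact map_mul x a b
  nonneg' := by
    intro a
    obtain ⟨a, rfl⟩ := Ideal.Quotient.mk_surjective a
    exact apply_nonneg x a
  eq_zero' := by
    intro a
    obtain ⟨a, rfl⟩ := Ideal.Quotient.mk_surjective a
    exact (Ideal.Quotient.eq_zero_iff_mem (I := seminormKer x)).symm
  add_le' := by
    intro a b
    obtain ⟨a, rfl⟩ := Ideal.Quotient.mk_surjective a
    obtain ⟨b, rfl⟩ := Ideal.Quotient.mk_surjective b
    exact map_add_le_add x a b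

theorem quotientAbs_mk (x : MulRingSeminorm A) (a : A) :
    quotientAbs x (Ideal.Quotient.mk (seminormKer x) a) = x a := rfl

variable {D : Type*} [CommRing D] [IsDomain D]

theorem fractionAbs_aux (v : AbsoluteValue D ℝ) {a b c d : D} (hb : b ≠ 0) (hd : d ≠ 0)
    (h : algebraMap D (FractionRing D) a / algebraMap D (FractionRing D) b =
      algebraMap D (FractionRing D) c / algebraMap D (FractionRing D) d) :
    v a / v b = v c / v d := by
  have inj := IsFractionRing.injective D (FractionRing D)
  have hb' : algebraMap D (FractionRing D) b ≠ 0 := by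
    simpa using (map_ne_zero_iff _ inj).mpr hb
  have hd' : algebraMap D (FractionRing D) d ≠ 0 := by
    simpa using (map_ne_zero_iff _ inj).mpr hd
  rw [div_eq_div_iff hb' hd', ← map_mul, ← map_mul] at h
  have h1 := congrArg v (inj h)
  rw [map_mul, map_mul] at h1
  rw [div_eq_div_iff (v.ne_zero hb) (v.ne_zero hd)]
  exact h1

theorem exists_fraction (z : FractionRing D) : ∃ p : D × D, p.2 ≠ 0 ∧
    z = algebraMap D (FractionRing D) p.1 / algebraMap D (FractionRing D) p.2 := by
  obtain ⟨a, b, hb, rfl⟩ := IsFractionRing.div_surjective (A := D) z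
  exact ⟨(a, b), nonZeroDivisors.ne_zero hb, rfl⟩

/-- The value `|a| / |b|` of a fraction `a / b`. -/
def fractionAbsFun (v : AbsoluteValue D ℝ) (z : FractionRing D) : ℝ :=
  v (exists_fraction z).choose.1 / v (exists_fraction z).choose.2

theorem fractionAbsFun_div (v : AbsoluteValue D ℝ) (a : D) {b : D} (hb : b ≠ 0) :
    fractionAbsFun v (algebraMap D (FractionRing D) a / algebraMap D (FractionRing D) b) =
      v a / v b :=
  (fractionAbs_aux v hb (exists_fraction _).choose_spec.1
    (exists_fraction (algebraMap D (FractionRing D) a /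
      algebraMap D (FractionRing D) b)).choose_spec.2).symm

/-- The extension of an absolute value to the field of fractions, `|a / b| = |a| / |b|`. -/
def fractionAbs (v : AbsoluteValue D ℝ) : AbsoluteValue (FractionRing D) ℝ where
  toFun := fractionAbsFun v
  map_mul' := by
    intro z w
    obtain ⟨⟨a, b⟩, hb, rfl⟩ := exists_fraction z
    obtain ⟨⟨c, d⟩, hd, rfl⟩ := exists_fraction w
    simp only at hb hd ⊢
    rw [div_mul_div_comm, ← map_mul, ← map_mul, fractionAbsFun_div v _ (mul_ne_zero hb hd),
      fractionAbsFun_div v _ hb, fractionAbsFun_div v _ hd, map_mul, map_mul, div_mul_div_comm]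
  nonneg' := by
    intro z
    exact div_nonneg (v.nonneg _) (v.nonneg _)
  eq_zero' := by
    intro z
    obtain ⟨⟨a, b⟩, hb, rfl⟩ := exists_fraction z
    simp only at hb ⊢
    have inj := IsFractionRing.injective D (FractionRing D)
    rw [fractionAbsFun_div v _ hb, div_eq_zero_iff, div_eq_zero_iff, v.eq_zero, v.eq_zero,
      map_eq_zero_iff _ inj, map_eq_zero_iff _ inj]
  add_le' := by
    intro z w
    obtain ⟨⟨a, b⟩, hb, rfl⟩ := exists_fraction z
    obtain ⟨⟨c, d⟩, hd, rfl⟩ := exists_fraction w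
    simp only at hb hd ⊢
    have inj := IsFractionRing.injective D (FractionRing D)
    have hb' : algebraMap D (FractionRing D) b ≠ 0 := by
      simpa using (map_ne_zero_iff _ inj).mpr hb
    have hd' : algebraMap D (FractionRing D) d ≠ 0 := by
      simpa using (map_ne_zero_iff _ inj).mpr hd
    rw [div_add_div _ _ hb' hd', ← map_mul, ← map_mul, ← map_mul, ← map_add,
      fractionAbsFun_div v _ (mul_ne_zero hb hd),
      fractionAbsFun_div v _ hb, fractionAbsFun_div v _ hd,
      div_add_div _ _ (v.ne_zero hb) (v.ne_zero hd), map_mul]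
    have hpos : 0 < v b * v d := mul_pos (v.pos hb) (v.pos hd)
    refine div_le_div_of_nonneg_right ?_ hpos.le
    have := v.add_le (a * d) (b * c)
    rwa [map_mul, map_mul] at this

theorem fractionAbs_div (v : AbsoluteValue D ℝ) (a : D) {b : D} (hb : b ≠ 0) :
    fractionAbs v (algebraMap D (FractionRing D) a / algebraMap D (FractionRing D) b) =
      v a / v b := fractionAbsFun_div v a hb

/-- The absolute value induced by a multiplicative seminorm `x` on `Frac (A / ker x)`. -/
def residueAbs (x : MulRingSeminorm A) : AbsoluteValue (FractionRing (A ⧸ seminormKer x)) ℝ :=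
  fractionAbs (quotientAbs x)

/-- The completed residue field of a multiplicative seminorm `x` on `A`: the completion of
`Frac (A / ker x)` for the absolute value induced by `x`. It is a `NormedField`. -/
abbrev CompletedResidueField (x : MulRingSeminorm A) : Type _ := (residueAbs x).Completion

/-- The evaluation map `f ↦ f(x)` from `A` to the completed residue field of `x`. -/
def residueEval (x : MulRingSeminorm A) : A →+* CompletedResidueField x :=
  (UniformSpace.Completion.coeRingHom (α := WithAbs (residueAbs x))).comp
    (((WithAbs.equiv (residueAbs x)).symm.toRingHom).comp
      ((algebraMap (A ⧸ seminormKer x) (FractionRing (A ⧸ seminormKer x))).comp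
        (Ideal.Quotient.mk (seminormKer x))))

end Residue

/-! ## The affine analytic space over a Banach ring and its analytic functions -/

/-- The points of the affine analytic space `𝔸^{n,an}_A` over a Banach ring `A`: multiplicative
seminorms on `A[T₁, …, Tₙ]` whose restriction to `A` is bounded by the norm of `A`.
For `A = ℤ` the norm is the usual absolute value. -/
structure AffineAn (A : Type*) [NormedCommRing A] (n : ℕ) where
  /-- the seminorm `|·|ₓ` -/
  toSeminorm : MulRingSeminorm (MvPolynomial (Fin n) A)
  bounded : ∀ a : A, toSeminorm (MvPolynomial.C a) ≤ ‖a‖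

namespace AffineAn

variable {A : Type*} [NormedCommRing A] {n : ℕ}

/-- The coarsest topology for which `x ↦ |P|ₓ` is continuous for every polynomial `P`. -/
instance : TopologicalSpace (AffineAn A n) :=
  TopologicalSpace.induced
    (fun (x : AffineAn A n) (P : MvPolynomial (Fin n) A) => x.toSeminorm P) inferInstance

/-- The completed residue field `ℋ(x)`. -/
abbrev ResidueField (x : AffineAn A n) : Type _ := CompletedResidueField x.toSeminorm

/-- The value `P(x) ∈ ℋ(x)` of a polynomial `P`. -/
def eval (x : AffineAn A n) (P : MvPolynomial (Fin n) A) : x.ResidueField :=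
  residueEval x.toSeminorm P

/-- `f ∈ 𝒪(V)`: `f` is a function on `V` with `f(x) ∈ ℋ(x)` which is, on a neighbourhood `W` of
each point of `V`, a uniform limit of fractions `P / Q` of polynomials such that `Q` has no zero
on `W`. -/
def IsAnalytic (V : Set (AffineAn A n)) (f : ∀ x : V, x.1.ResidueField) : Prop :=
  ∀ x : V, ∃ W : Set (AffineAn A n), IsOpen W ∧ x.1 ∈ W ∧ W ⊆ V ∧
    ∀ δ : ℝ, 0 < δ → ∃ P Q : MvPolynomial (Fin n) A,
      (∀ y ∈ W, y.toSeminorm Q ≠ 0) ∧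
      ∀ y : V, y.1 ∈ W → ‖f y - y.1.eval P / y.1.eval Q‖ ≤ δ

end AffineAn

/-! ## The Berkovich projective line over a valued field, disks and annuli -/

/-- The points of the affine analytic line over a valued field `k`: multiplicative seminorms on
`k[T]` extending the absolute value of `k`. -/
structure AffineLineAn (k : Type*) [NormedField k] where
  /-- the seminorm -/
  toSeminorm : MulRingSeminorm (Polynomial k)
  extends_norm : ∀ a : k, toSeminorm (Polynomial.C a) = ‖a‖

/-- The underlying set of the Berkovich projective line over `k`. -/
abbrev ProjLineAn (k : Type*) [NormedField k] : Type _ := OnePoint (AffineLineAn k)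

section Disks

variable {k : Type*} [NormedField k]

/-- The closed disk `D(a, r) = {|T - a| ≤ r}`. -/
def closedDisk (a : k) (r : ℝ) : Set (ProjLineAn k) :=
  (fun y : AffineLineAn k => (y : ProjLineAn k)) ''
    {y | y.toSeminorm (Polynomial.X - Polynomial.C a) ≤ r}

/-- The open disk `{|T - a| < r}`. -/
def openDisk (a : k) (r : ℝ) : Set (ProjLineAn k) :=
  (fun y : AffineLineAn k => (y : ProjLineAn k)) ''
    {y | y.toSeminorm (Polynomial.X - Polynomial.C a) < r}

/-- The disks `D(α, R)` and `D(β, r)` cut out the annulus `A`: either one of the two closed disks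
lies in the open disk with the centre and radius of the other, and `A` is the difference, or the
two disks are disjoint and `A` is the complement of their union. -/
def CutOutAnnulus (α : k) (R : ℝ) (β : k) (r : ℝ) (A : Set (ProjLineAn k)) : Prop :=
  (closedDisk β r ⊆ openDisk α R ∧ A = closedDisk α R \ closedDisk β r) ∨
  (closedDisk α R ⊆ openDisk β r ∧ A = closedDisk β r \ closedDisk α R) ∨
  (Disjoint (closedDisk α R) (closedDisk β r) ∧ A = (closedDisk α R)ᶜ \ closedDisk β r)

end Disks

/-! ## The modulus over `ℂ` -/

/-- The affine coordinate on the Riemann sphere `ℂ ∪ {∞}` (with value `0` at `∞`). -/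
def sphereCoord (p : OnePoint ℂ) : ℂ := p.elim 0 id

/-- Holomorphy on an open set `U ⊆ ℂ` of a map to the Riemann sphere: it is continuous, and
holomorphic when read in the chart `w` away from `∞` and in the chart `1 / w` away from `0`. -/
def IsHolomorphicToSphere (f : ℂ → OnePoint ℂ) (U : Set ℂ) : Prop :=
  ContinuousOn f U ∧ ∀ z ∈ U,
    (f z ≠ OnePoint.infty → DifferentiableAt ℂ (fun w => sphereCoord (f w)) z) ∧
    (f z ≠ ((0 : ℂ) : OnePoint ℂ) → DifferentiableAt ℂ (fun w => (sphereCoord (f w))⁻¹) z)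

/-- The interior of `A ⊆ ℙ¹(ℂ)` is conformally equivalent to `{1 < |z| < e^m}`. -/
def HasComplexModulus (A : Set (OnePoint ℂ)) (m : ℝ) : Prop :=
  0 < m ∧ ∃ f : ℂ → OnePoint ℂ,
    IsHolomorphicToSphere f {z : ℂ | 1 < ‖z‖ ∧ ‖z‖ < Real.exp m} ∧
    BijOn f {z : ℂ | 1 < ‖z‖ ∧ ‖z‖ < Real.exp m} (interior A)

/-- The modulus of an annulus in `ℙ¹(ℂ)`: the unique `m > 0` such that its interior is conformally
equivalent to `{1 < |z| < e^m}`. In particular `D(0,1) \ D(0,s)` has modulus `-log s`. -/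
def complexModulus (A : Set (OnePoint ℂ)) : ℝ := sSup {m : ℝ | HasComplexModulus A m}

/-! ## The modulus over a complete valued field -/

/-- An identification of the absolute value of `k` with `|·|_∞ ^ ε`, `ε ∈ (0, 1]`, through an
embedding of `k` in `ℂ`. When `k` is complete the image is `ℝ` or `ℂ`. -/
structure ArchStructure (k : Type*) [NormedField k] where
  /-- the exponent -/
  ε : ℝ
  ε_pos : 0 < ε
  ε_le_one : ε ≤ 1
  /-- the embedding -/
  σ : k →+* ℂ
  norm_eq : ∀ a : k, ‖a‖ = ‖σ a‖ ^ ε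

namespace ArchStructure

variable {k : Type*} [NormedField k]

/-- The point `P ↦ |P(z)|_∞ ^ ε` of the affine line over `k` defined by `z ∈ ℂ`. -/
def affinePoint (d : ArchStructure k) (z : ℂ) : AffineLineAn k where
  toSeminorm :=
    { toFun := fun P => ‖P.eval₂ d.σ z‖ ^ d.ε
      map_zero' := by simp [Real.zero_rpow d.ε_pos.ne']
      add_le' := by
        intro P Q
        rw [Polynomial.eval₂_add]
        exact (Real.rpow_le_rpow (norm_nonneg _) (norm_add_le _ _) d.ε_pos.le).trans
          (Real.rpow_add_le_add_rpow (norm_nonneg _) (norm_nonneg _) d.ε_pos.le d.ε_le_one)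
      neg' := by intro P; simp
      map_one' := by simp
      map_mul' := by
        intro P Q
        rw [Polynomial.eval₂_mul, norm_mul, Real.mul_rpow (norm_nonneg _) (norm_nonneg _)] }
  extends_norm := by
    intro a
    change ‖(Polynomial.C a).eval₂ d.σ z‖ ^ d.ε = ‖a‖
    rw [Polynomial.eval₂_C, d.norm_eq]

/-- The natural map from `ℙ¹(ℂ)` to the Berkovich projective line over `k`. For `k = ℂ` it is
bijective, for `k = ℝ` it identifies conjugate points. -/
def projPoint (d : ArchStructure k) : OnePoint ℂ → ProjLineAn k := OnePoint.map d.affinePoint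

end ArchStructure

/-- The distance in the Berkovich tree, for the interval length metric, between the boundary
points `η_{a,r}` of `D(a, r)` and `η_{b,s}` of `D(b, s)`, over a non-Archimedean field. -/
def treeDist {k : Type*} [NormedField k] (a : k) (r : ℝ) (b : k) (s : ℝ) : ℝ :=
  if ‖a - b‖ ≤ max r s then |Real.log (r / s)|
  else |Real.log (‖a - b‖ / r)| + |Real.log (s / ‖a - b‖)|

/-- A valued field is non-Archimedean if it satisfies the ultrametric inequality. -/
def IsNonArch (k : Type*) [NormedField k] : Prop := ∀ a b : k, ‖a + b‖ ≤ max ‖a‖ ‖b‖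

open Classical in
/-- The modulus, over a complete valued field `k`, of the annulus `A` cut out by `D(α, R)` and
`D(β, r)`. If the absolute value of `k` is `|·|_∞ ^ ε` it is `ε` times the modulus of the induced
annulus in `ℙ¹(ℂ)`; otherwise `k` is non-Archimedean and it is the distance between the boundary
points of the two disks. -/
def annulusModulus {k : Type*} [NormedField k] (α : k) (R : ℝ) (β : k) (r : ℝ)
    (A : Set (ProjLineAn k)) : ℝ :=
  if h : Nonempty (ArchStructure k) then
    h.some.ε * complexModulus (h.some.projPoint ⁻¹' A)
  else treeDist α R β r

end

/-! The modulus depends on `x` only through four real numbers that vary continuously with `x`: `d =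
‖α x - β x‖`, `R`, `r` and `‖2‖`. The last one decides the type of the residue field. If `‖2‖ ≤ 1`,
binary expansions bound all integers and the field is ultrametric. If `‖2‖ > 1`, Ostrowski's theorem
and the real Gelfand–Mazur theorem embed the field in `ℂ`, with norm `|·| ^ ε` and `ε = log₂ ‖2‖`
(`nonempty_archStructure`).

In the Archimedean case the two disks become Euclidean disks with radii `R ^ (1/ε)`, `r ^ (1/ε)` and
centres `d ^ (1/ε)` apart. A Möbius map makes their boundary circles concentric, and concentric
annuli of different moduli are not conformally equivalent (`eq_of_bijOn_annulus`). Hence the modulus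
is an explicit `arcosh` (`complexModulus_nested`, `complexModulus_disjoint`). After multiplication
by `ε` it is `archModulus`, which is continuous as long as `ε > 0`.

In the non-Archimedean case, cutting out an annulus forces one of `d`, `R`, `r` to be strictly
larger than the two others, and the tree distance is `2 log max(d, R, r) - log R - log r`. The same
expression is the limit of `archModulus` as `ε → 0`: `arcosh y` differs from `log y` by at most `log
2`, which the factor `ε` kills, and the powers `1/ε` let the largest of the three numbers dominate
(`tendsto_archModulus`). Archimedean points can accumulate only at non-Archimedean points with `‖2‖
= 1`, and there `ε → 0`.

A recurrent device is to apply an estimate to `N`-th powers: an exponential bounded by a linear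
function of `N` has base at most `1`. -/

theorem le_one_of_pow_le_mul_succ {t C : ℝ} (h : ∀ N : ℕ, t ^ N ≤ C * (N + 1)) :
    t ≤ 1 := by
  by_contra! ht
  have h0 : 0 < t := by linarith
  have hs : |t⁻¹| < 1 := by
    rw [abs_of_pos (by positivity)]
    exact inv_lt_one_of_one_lt₀ ht
  have h1 := tendsto_pow_const_mul_const_pow_of_abs_lt_one 1 hs
  have h2 := tendsto_pow_const_mul_const_pow_of_abs_lt_one 0 hs
  have h3 := (h1.add h2).const_mul C
  simp only [pow_one, pow_zero, one_mul, add_zero, mul_zero] at h3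
  obtain ⟨N, hN⟩ := (h3.eventually (gt_mem_nhds one_pos)).exists
  have := h N
  have hp : (0 : ℝ) < t ^ N := by positivity
  have e : C * (N * t⁻¹ ^ N + t⁻¹ ^ N) = C * (N + 1) / t ^ N := by
    rw [inv_pow]; field_simp
  rw [e, div_lt_one hp] at hN
  linarith

/-! ### Archimedean and ultrametric fields, told apart by the norm of 2 -/

section Arch

variable {k : Type*} [NormedField k]

theorem norm_natCast_le_self (n : ℕ) : ‖(n : k)‖ ≤ n := by
  simpa using Nat.norm_cast_le (α := k) n

/-- Horner's scheme in base 2: each of the `j` digits contributes at most `1`, since multiplication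
by `2` does not increase the norm. -/
theorem norm_natCast_le_of_norm_two_le_one (h : ‖(2 : k)‖ ≤ 1) (j n : ℕ) (hn : n < 2 ^ j) :
    ‖(n : k)‖ ≤ j := by
  induction j generalizing n with
  | zero =>
    have : n = 0 := by simpa using hn
    simp [this]
  | succ j ih =>
    have h1 := ih (n / 2) (by rw [pow_succ] at hn; omega)
    have h2 : (n : k) = 2 * ((n / 2 : ℕ) : k) + ((n % 2 : ℕ) : k) := by
      have : n = 2 * (n / 2) + n % 2 := (Nat.div_add_mod n 2).symm
      conv_lhs => rw [this]
      push_cast; ring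
    have h3 : ‖((n % 2 : ℕ) : k)‖ ≤ 1 := by
      refine (norm_natCast_le_self _).trans ?_
      have : n % 2 ≤ 1 := by omega
      exact_mod_cast this
    have h4 : ‖(2 : k) * ((n / 2 : ℕ) : k)‖ ≤ 1 * j := by
      rw [norm_mul]
      exact mul_le_mul h h1 (norm_nonneg _) zero_le_one
    rw [h2]
    refine (norm_add_le _ _).trans ?_
    push_cast
    linarith

/-- The number `n ^ N` has at most `n * N + 1` binary digits, so `‖n‖ ^ N` grows at most linearly in
`N` and `‖n‖ ≤ 1`. A norm bounded by `1` on the integers is ultrametric. -/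
theorem isNonArch_of_norm_two_le_one (h : ‖(2 : k)‖ ≤ 1) : IsNonArch k := by
  have key : ∀ n : ℕ, ‖(n : k)‖ ≤ 1 := by
    intro n
    apply le_one_of_pow_le_mul_succ (C := (n : ℝ) + 1)
    intro N
    rw [← norm_pow, ← Nat.cast_pow]
    have := norm_natCast_le_of_norm_two_le_one h (n * N + 1) (n ^ N) (by
      calc n ^ N ≤ (2 ^ n) ^ N := Nat.pow_le_pow_left Nat.lt_two_pow_self.le N
        _ = 2 ^ (n * N) := by rw [pow_mul]
        _ < 2 ^ (n * N + 1) := by rw [pow_succ]; have : 0 < 2 ^ (n * N) := by positivity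
                                  omega)
    refine this.trans ?_
    push_cast
    have : (0 : ℝ) ≤ n := Nat.cast_nonneg _
    have : (0 : ℝ) ≤ N := Nat.cast_nonneg _
    nlinarith
  have := isUltrametricDist_iff_forall_norm_natCast_le_one.mpr key
  intro a b
  exact this.norm_add_le_max a b

theorem ArchStructure.norm_two (d : ArchStructure k) : ‖(2 : k)‖ = 2 ^ d.ε := by
  rw [d.norm_eq, map_ofNat, Complex.norm_ofNat]

theorem ArchStructure.one_lt_norm_two (d : ArchStructure k) : 1 < ‖(2 : k)‖ := by
  rw [d.norm_two]
  exact Real.one_lt_rpow one_lt_two d.ε_pos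

/-- The exponent does not depend on the chosen structure, and it is a continuous function of `‖2‖`.
-/
theorem ArchStructure.ε_eq (d : ArchStructure k) : d.ε = Real.logb 2 ‖(2 : k)‖ := by
  rw [d.norm_two, Real.logb_rpow (by norm_num) (by norm_num)]

theorem norm_two_le_one_of_isNonArch (h : IsNonArch k) : ‖(2 : k)‖ ≤ 1 := by
  have := h 1 1
  rwa [one_add_one_eq_two, norm_one, max_self] at this

/-- In characteristic `p > 0` the powers of `2` take finitely many values, so their norms cannot
grow. -/
theorem charZero_of_one_lt_norm_two (h : 1 < ‖(2 : k)‖) : CharZero k := by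
  obtain ⟨p, hp⟩ := CharP.exists k
  rcases Nat.eq_zero_or_pos p with rfl | hpos
  · exact CharP.charP_to_charZero k
  exfalso
  have hb : ∀ N : ℕ, ‖(2 : k)‖ ^ N ≤ p * (N + 1) := by
    intro N
    have e : (2 : k) ^ N = ((2 ^ N % p : ℕ) : k) := by
      rw [← CharP.cast_eq_mod]; push_cast; rfl
    rw [← norm_pow, e]
    have h1 := norm_natCast_le_self (k := k) (2 ^ N % p)
    have h2 : ((2 ^ N % p : ℕ) : ℝ) ≤ p := by exact_mod_cast (Nat.mod_lt _ hpos).le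
    have : (0 : ℝ) ≤ N := Nat.cast_nonneg _
    have : (0 : ℝ) ≤ p := Nat.cast_nonneg _
    nlinarith
  exact absurd (le_one_of_pow_le_mul_succ hb) (not_le.mpr h)

/-- Ostrowski's theorem for the restriction of the norm to `ℚ`. The bound `ε ≤ 1` is the triangle
inequality `‖1 + 1‖ ≤ 2`. -/
theorem exists_norm_natCast_eq_rpow (h : 1 < ‖(2 : k)‖) :
    ∃ ε : ℝ, 0 < ε ∧ ε ≤ 1 ∧ ∀ n : ℕ, ‖(n : k)‖ = (n : ℝ) ^ ε := by
  have := charZero_of_one_lt_norm_two h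
  let f : AbsoluteValue ℚ ℝ := (NormedField.toAbsoluteValue k).comp
    (f := Rat.castHom k) (Rat.castHom k).injective
  have hf : ∀ n : ℕ, f n = ‖(n : k)‖ := by
    intro n
    change ‖(Rat.castHom k) n‖ = _
    simp
  have nb : ¬ ∀ n : ℕ, f n ≤ 1 := by
    intro hb
    have := hb 2
    rw [hf] at this
    push_cast at this
    linarith
  have he := Rat.AbsoluteValue.equiv_real_of_unbounded nb
  obtain ⟨c, hc, hn⟩ := (Rat.AbsoluteValue.exists_nat_rpow_iff_isEquiv).mpr he
  have hn' : ∀ n : ℕ, ‖(n : k)‖ = (n : ℝ) ^ c⁻¹ := by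
    intro n
    have := hn n
    rw [hf] at this
    simp only [Rat.AbsoluteValue.real_eq_abs, Rat.cast_natCast, Nat.abs_cast] at this
    rw [← this, Real.rpow_rpow_inv (norm_nonneg _) hc.ne']
  refine ⟨c⁻¹, by positivity, ?_, hn'⟩
  by_contra! hlt
  have h2 := hn' 2
  have h3 := norm_natCast_le_self (k := k) 2
  rw [h2] at h3
  have := Real.rpow_lt_rpow_of_exponent_lt (x := 2) one_lt_two hlt
  push_cast at h3
  rw [Real.rpow_one] at this
  linarith

/-- A normed field whose norm restricts to the `ε`-th power of the usual absolute value satisfies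
the triangle inequality for the `1 / ε`-th power of the norm. -/
theorem norm_rpow_inv_add_le {ε : ℝ} (hε : 0 < ε) (hn : ∀ n : ℕ, ‖(n : k)‖ = (n : ℝ) ^ ε)
    (a b : k) : ‖a + b‖ ^ ε⁻¹ ≤ ‖a‖ ^ ε⁻¹ + ‖b‖ ^ ε⁻¹ := by
  set A := ‖a‖ ^ ε⁻¹ with hA
  set B := ‖b‖ ^ ε⁻¹ with hB
  have hA0 : 0 ≤ A := by positivity
  have hB0 : 0 ≤ B := by positivity
  have ha : ‖a‖ = A ^ ε := by rw [hA, Real.rpow_inv_rpow (norm_nonneg _) hε.ne']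
  have hb : ‖b‖ = B ^ ε := by rw [hB, Real.rpow_inv_rpow (norm_nonneg _) hε.ne']
  rw [Real.rpow_inv_le_iff_of_pos (norm_nonneg _) (by positivity) hε]
  rcases eq_or_lt_of_le (add_nonneg hA0 hB0) with h0 | hpos
  · have hA' : A = 0 := by linarith
    have hB' : B = 0 := by linarith
    have ha' : a = 0 := by rw [← norm_eq_zero, ha, hA', Real.zero_rpow hε.ne']
    have hb' : b = 0 := by rw [← norm_eq_zero, hb, hB', Real.zero_rpow hε.ne']
    simp only [ha', hb', add_zero, norm_zero]
    positivity
  have hS : 0 < (A + B) ^ ε := by positivity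
  rw [← div_le_one hS]
  -- In the binomial expansion of `(a + b) ^ N` each term has norm `(A ^ i * B ^ (N - i) * N.choose
  -- i) ^ ε`, and the base is one term of `(A + B) ^ N`. Hence there are `N + 1` terms, each at most
  -- `((A + B) ^ N) ^ ε`.
  apply le_one_of_pow_le_mul_succ (C := 1)
  intro N
  rw [div_pow, div_le_iff₀ (by positivity), ← norm_pow, add_pow, one_mul]
  refine (norm_sum_le _ _).trans ?_
  have : ∀ i ∈ Finset.range (N + 1),
      ‖a ^ i * b ^ (N - i) * (N.choose i : k)‖ ≤ ((A + B) ^ ε) ^ N := by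
    intro i hi
    rw [norm_mul, norm_mul, norm_pow, norm_pow, hn, ha, hb, ← Real.rpow_mul_natCast hA0,
      mul_comm ε, Real.rpow_natCast_mul hA0, ← Real.rpow_mul_natCast hB0,
      mul_comm ε, Real.rpow_natCast_mul hB0, ← Real.mul_rpow (by positivity) (by positivity),
      ← Real.mul_rpow (by positivity) (by positivity), ← Real.rpow_mul_natCast hpos.le,
      mul_comm ε, Real.rpow_natCast_mul hpos.le]
    refine Real.rpow_le_rpow (by positivity) ?_ hε.le
    rw [add_pow A B N]
    exact Finset.single_le_sum (f := fun i => A ^ i * B ^ (N - i) * (N.choose i : ℝ))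
      (fun _ _ => by positivity) hi
  refine (Finset.sum_le_card_nsmul _ _ _ this).trans ?_
  simp

end Arch

/-! ### Embedding an Archimedean field in the complex numbers -/

/-- A complete normed field whose norm restricts to the usual absolute value of `ℕ` embeds
isometrically in `ℂ`. -/
theorem exists_isometric_embedding_complex (L : Type*) [NormedField L] [CompleteSpace L]
    (hn : ∀ n : ℕ, ‖(n : L)‖ = n) : ∃ σ : L →+* ℂ, ∀ a, ‖σ a‖ = ‖a‖ := by
  have : CharZero L := by
    refine charZero_of_inj_zero fun n h => ?_
    have := hn n
    rw [h, norm_zero] at this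
    exact_mod_cast this.symm
  have hq : ∀ q : ℚ, ‖(q : L)‖ = |(q : ℝ)| := by
    have hz : ∀ z : ℤ, ‖(z : L)‖ = |(z : ℝ)| := by
      intro z
      obtain ⟨n, rfl | rfl⟩ := z.eq_nat_or_neg <;> simp [hn]
    intro q
    rw [Rat.cast_def, norm_div, hz, hn, Rat.cast_def, abs_div, Nat.abs_cast]
  let i : ℚ →+* ℝ := Rat.castHom ℝ
  let f : ℚ →+* L := Rat.castHom L
  have hi : IsUniformInducing i := Rat.isUniformEmbedding_coe_real.isUniformInducing
  have hd : DenseRange i := Rat.isDenseEmbedding_coe_real.dense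
  have hfi : Isometry f := by
    refine AddMonoidHomClass.isometry_of_norm f ?_
    intro q
    change ‖(q : L)‖ = _
    rw [hq]; rfl
  -- The map `ℚ → L` is an isometry, so it extends to `ℝ` by completeness of `L`. This makes `L` a
  -- real normed field, and Gelfand–Mazur leaves only `ℝ` and `ℂ`.
  let φ : ℝ →+* L := IsDenseInducing.extendRingHom hi hd hfi.uniformContinuous
  have hφq : ∀ q : ℚ, φ q = q := fun q => map_ratCast φ q
  have hφc : Continuous φ :=
    (uniformContinuous_uniformly_extend hi hd hfi.uniformContinuous).continuous
  have hφn : ∀ x : ℝ, ‖φ x‖ = |x| := by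
    intro x
    have : (fun x : ℝ => ‖φ x‖) = fun x => |x| := by
      refine hd.equalizer (by fun_prop) (by fun_prop) ?_
      ext q
      change ‖φ (q : ℝ)‖ = |(q : ℝ)|
      rw [hφq, hq]
    exact congrFun this x
  let _ : Algebra ℝ L := φ.toAlgebra
  let _ : NormedAlgebra ℝ L :=
    { norm_smul_le := by
        intro x a
        rw [Algebra.smul_def, norm_mul]
        change ‖φ x‖ * _ ≤ _
        rw [hφn, Real.norm_eq_abs] }
  have key : ∃ s : L →ₐ[ℝ] ℂ, FiniteDimensional ℝ L := by
    rcases NormedAlgebra.Real.nonempty_algEquiv_or L with ⟨⟨e⟩⟩ | ⟨⟨e⟩⟩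
    · exact ⟨(Algebra.ofId ℝ ℂ).comp e.toAlgHom, e.toLinearEquiv.symm.finiteDimensional⟩
    · exact ⟨e.toAlgHom, e.toLinearEquiv.symm.finiteDimensional⟩
  obtain ⟨s, hfin⟩ := key
  have hs : Continuous s := s.toLinearMap.continuous_of_finiteDimensional
  let S : L →L[ℝ] ℂ := ⟨s.toLinearMap, hs⟩
  -- So far `s` is only bounded. Passing to powers of `a` replaces its operator norm by `1`;
  -- inverses then give the opposite inequality.
  have hle : ∀ a, ‖s a‖ ≤ ‖a‖ := by
    intro a
    rcases eq_or_ne a 0 with rfl | ha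
    · simp
    have hpos : 0 < ‖a‖ := norm_pos_iff.mpr ha
    rw [← div_le_one hpos]
    apply le_one_of_pow_le_mul_succ (C := ‖S‖)
    intro N
    have h1 : ‖s (a ^ N)‖ ≤ ‖S‖ * ‖a ^ N‖ := S.le_opNorm (a ^ N)
    rw [map_pow, norm_pow, norm_pow] at h1
    rw [div_pow, div_le_iff₀ (by positivity)]
    refine h1.trans ?_
    have h2 : 0 ≤ ‖S‖ * ‖a‖ ^ N := by positivity
    have h3 : (0 : ℝ) ≤ N := Nat.cast_nonneg _
    nlinarith
  refine ⟨s.toRingHom, fun a => le_antisymm (hle a) ?_⟩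
  change ‖a‖ ≤ ‖s a‖
  rcases eq_or_ne a 0 with rfl | ha
  · simp
  have h1 := hle a⁻¹
  rw [map_inv₀, norm_inv, norm_inv] at h1
  have hsa : s a ≠ 0 := (map_ne_zero s).mpr ha
  exact (inv_le_inv₀ (norm_pos_iff.mpr hsa) (norm_pos_iff.mpr ha)).mp h1

/-- The power `‖·‖ ^ (1/ε)` is again an absolute value, now standard on `ℕ`. Its completion embeds
isometrically in `ℂ`. -/
theorem nonempty_archStructure {k : Type*} [NormedField k] (h : 1 < ‖(2 : k)‖) :
    Nonempty (ArchStructure k) := by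
  obtain ⟨ε, h0, h1, hn⟩ := exists_norm_natCast_eq_rpow h
  let w : AbsoluteValue k ℝ :=
    { toFun := fun a => ‖a‖ ^ ε⁻¹
      map_mul' := fun a b => by rw [norm_mul, Real.mul_rpow (norm_nonneg _) (norm_nonneg _)]
      nonneg' := fun a => by positivity
      eq_zero' := fun a => by
        rw [Real.rpow_eq_zero (norm_nonneg _) (by positivity), norm_eq_zero]
      add_le' := norm_rpow_inv_add_le h0 hn }
  let j : k →+* w.Completion := (UniformSpace.Completion.coeRingHom (α := WithAbs w)).comp
    (WithAbs.equiv w).symm.toRingHom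
  have hj : ∀ a, ‖j a‖ = ‖a‖ ^ ε⁻¹ := by
    intro a
    exact UniformSpace.Completion.norm_coe _
  obtain ⟨σ, hσ⟩ := exists_isometric_embedding_complex w.Completion (by
    intro n
    have := hj n
    rwa [map_natCast, hn, Real.rpow_rpow_inv (Nat.cast_nonneg _) h0.ne'] at this)
  refine ⟨⟨ε, h0, h1, σ.comp j, fun a => ?_⟩⟩
  rw [RingHom.comp_apply, hσ, hj, Real.rpow_inv_rpow (norm_nonneg _) h0.ne']

theorem nonempty_archStructure_iff {k : Type*} [NormedField k] :
    Nonempty (ArchStructure k) ↔ 1 < ‖(2 : k)‖ :=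
  ⟨fun ⟨d⟩ => d.one_lt_norm_two, nonempty_archStructure⟩

/-! ### Disks in the Berkovich line and test points for their relative position -/

section Disks

variable {k : Type*} [NormedField k]

theorem coe_mem_closedDisk {a : k} {s : ℝ} {y : AffineLineAn k} :
    (y : ProjLineAn k) ∈ closedDisk a s ↔
      y.toSeminorm (Polynomial.X - Polynomial.C a) ≤ s :=
  OnePoint.coe_injective.mem_set_image

theorem coe_mem_openDisk {a : k} {s : ℝ} {y : AffineLineAn k} :
    (y : ProjLineAn k) ∈ openDisk a s ↔
      y.toSeminorm (Polynomial.X - Polynomial.C a) < s :=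
  OnePoint.coe_injective.mem_set_image

/-- The point of the affine line defined by an element of the field. -/
noncomputable def AffineLineAn.ofElement (c : k) : AffineLineAn k where
  toSeminorm :=
    { toFun := fun P => ‖P.eval c‖
      map_zero' := by simp
      add_le' := fun P Q => by rw [Polynomial.eval_add]; exact norm_add_le _ _
      neg' := fun P => by simp
      map_one' := by simp
      map_mul' := fun P Q => by rw [Polynomial.eval_mul, norm_mul] }
  extends_norm := fun a => by
    change ‖(Polynomial.C a).eval c‖ = ‖a‖
    simp

theorem AffineLineAn.ofElement_X_sub_C (c a : k) :
    (AffineLineAn.ofElement c).toSeminorm (Polynomial.X - Polynomial.C a) = ‖c - a‖ := by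
  change ‖(Polynomial.X - Polynomial.C a).eval c‖ = _
  simp

theorem isNonarchimedean_toAbsoluteValue (h : IsNonArch k) :
    IsNonarchimedean (NormedField.toAbsoluteValue k) := fun a b => h a b

/-- The Gauss point `η_{b, s}`. -/
noncomputable def AffineLineAn.gaussPoint (h : IsNonArch k) (b : k) {s : ℝ} (hs : 0 < s) :
    AffineLineAn k where
  toSeminorm :=
    { toFun := fun P => (P.comp (Polynomial.X + Polynomial.C b)).gaussNorm
        (NormedField.toAbsoluteValue k) s
      map_zero' := by simp
      add_le' := fun P Q => by
        rw [Polynomial.add_comp]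
        exact (Polynomial.gaussNorm_isAbsoluteValue
          (isNonarchimedean_toAbsoluteValue h) hs).abv_add' _ _
      neg' := fun P => by
        rw [Polynomial.neg_comp, ← neg_one_mul, ← Polynomial.C_1, ← Polynomial.C_neg,
          Polynomial.gaussNorm_mul (isNonarchimedean_toAbsoluteValue h) hs,
          Polynomial.gaussNorm_C, map_neg_eq_map, map_one, one_mul]
      map_one' := by
        rw [Polynomial.one_comp, ← Polynomial.C_1, Polynomial.gaussNorm_C, map_one]
      map_mul' := fun P Q => by
        rw [Polynomial.mul_comp]
        exact Polynomial.gaussNorm_mul (isNonarchimedean_toAbsoluteValue h) hs _ _ }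
  extends_norm := fun a => by
    change ((Polynomial.C a).comp (Polynomial.X + Polynomial.C b)).gaussNorm
        (NormedField.toAbsoluteValue k) s = _
    rw [Polynomial.C_comp, Polynomial.gaussNorm_C]
    rfl

theorem AffineLineAn.gaussPoint_X_sub_C_self (h : IsNonArch k) (b : k) {s : ℝ} (hs : 0 < s) :
    (AffineLineAn.gaussPoint h b hs).toSeminorm (Polynomial.X - Polynomial.C b) = s := by
  change ((Polynomial.X - Polynomial.C b).comp (Polynomial.X + Polynomial.C b)).gaussNorm
        (NormedField.toAbsoluteValue k) s = _
  have : (Polynomial.X - Polynomial.C b).comp (Polynomial.X + Polynomial.C b) =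
      Polynomial.monomial 1 (1 : k) := by
    simp [Polynomial.monomial_one_one_eq_X]
  rw [this, Polynomial.gaussNorm_monomial]
  simp

/-- The linear coefficient of `X + b - a` is `1`, and it is weighted by `s`. -/
theorem AffineLineAn.le_gaussPoint_X_sub_C (h : IsNonArch k) (a b : k) {s : ℝ} (hs : 0 < s) :
    s ≤ (AffineLineAn.gaussPoint h b hs).toSeminorm (Polynomial.X - Polynomial.C a) := by
  change s ≤ ((Polynomial.X - Polynomial.C a).comp (Polynomial.X + Polynomial.C b)).gaussNorm
        (NormedField.toAbsoluteValue k) s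
  have := Polynomial.le_gaussNorm (NormedField.toAbsoluteValue k)
    ((Polynomial.X - Polynomial.C a).comp (Polynomial.X + Polynomial.C b)) hs.le 1
  refine le_trans (le_of_eq ?_) this
  simp [Polynomial.coeff_X]

/-- The centre `b` detects the distance of the centres. The radius needs the Gauss point `η_{b, r}`:
points of `k` may miss it when the norm of `k` takes few values. -/
theorem lt_of_closedDisk_subset_openDisk (h : IsNonArch k) {a b : k} {R r : ℝ} (hr : 0 < r)
    (hsub : closedDisk b r ⊆ openDisk a R) : r < R ∧ ‖a - b‖ < R := by
  constructor
  · have h1 : ((AffineLineAn.gaussPoint h b hr : AffineLineAn k) : ProjLineAn k) ∈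
        closedDisk b r :=
      coe_mem_closedDisk.mpr (AffineLineAn.gaussPoint_X_sub_C_self h b hr).le
    exact (AffineLineAn.le_gaussPoint_X_sub_C h a b hr).trans_lt (coe_mem_openDisk.mp (hsub h1))
  · have h1 : ((AffineLineAn.ofElement b : AffineLineAn k) : ProjLineAn k) ∈ closedDisk b r := by
      rw [coe_mem_closedDisk, AffineLineAn.ofElement_X_sub_C, sub_self, norm_zero]
      exact hr.le
    have h2 := coe_mem_openDisk.mp (hsub h1)
    rwa [AffineLineAn.ofElement_X_sub_C, norm_sub_rev] at h2

theorem lt_of_disjoint_closedDisk {a b : k} {R r : ℝ} (hR : 0 < R) (hr : 0 < r)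
    (hd : Disjoint (closedDisk a R) (closedDisk b r)) : R < ‖a - b‖ ∧ r < ‖a - b‖ := by
  have ha : ∀ (c : k) {s : ℝ}, 0 < s →
      ((AffineLineAn.ofElement c : AffineLineAn k) : ProjLineAn k) ∈ closedDisk c s := by
    intro c s hs
    rw [coe_mem_closedDisk, AffineLineAn.ofElement_X_sub_C, sub_self, norm_zero]
    exact hs.le
  constructor
  · by_contra! hle
    refine Set.disjoint_left.mp hd ?_ (ha b hr)
    rwa [coe_mem_closedDisk, AffineLineAn.ofElement_X_sub_C, norm_sub_rev]
  · by_contra! hle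
    refine Set.disjoint_left.mp hd (ha a hR) ?_
    rwa [coe_mem_closedDisk, AffineLineAn.ofElement_X_sub_C]

theorem CutOutAnnulus.lt_of_isNonArch (h : IsNonArch k) {a b : k} {R r : ℝ} (hR : 0 < R)
    (hr : 0 < r) {A : Set (ProjLineAn k)} (hA : CutOutAnnulus a R b r A) :
    (r < R ∧ ‖a - b‖ < R) ∨ (R < r ∧ ‖a - b‖ < r) ∨ (R < ‖a - b‖ ∧ r < ‖a - b‖) := by
  rcases hA with ⟨h1, -⟩ | ⟨h1, -⟩ | ⟨h1, -⟩
  · exact Or.inl (lt_of_closedDisk_subset_openDisk h hr h1)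
  · have := lt_of_closedDisk_subset_openDisk h hR h1
    rw [norm_sub_rev] at this
    exact Or.inr (Or.inl this)
  · exact Or.inr (Or.inr (lt_of_disjoint_closedDisk hR hr h1))

end Disks

/-! ### Disks over an Archimedean field as Euclidean disks -/

section ArchDisks

variable {k : Type*} [NormedField k] (d : ArchStructure k)

theorem ArchStructure.affinePoint_X_sub_C (z : ℂ) (a : k) :
    (d.affinePoint z).toSeminorm (Polynomial.X - Polynomial.C a) = ‖z - d.σ a‖ ^ d.ε := by
  change ‖(Polynomial.X - Polynomial.C a).eval₂ d.σ z‖ ^ d.ε = _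
  simp

theorem ArchStructure.projPoint_coe (z : ℂ) :
    d.projPoint (z : OnePoint ℂ) = ((d.affinePoint z : AffineLineAn k) : ProjLineAn k) := rfl

theorem ArchStructure.preimage_closedDisk (a : k) {s : ℝ} (hs : 0 < s) :
    d.projPoint ⁻¹' closedDisk a s =
      ((↑) : ℂ → OnePoint ℂ) '' Metric.closedBall (d.σ a) (s ^ d.ε⁻¹) := by
  ext w
  induction w using OnePoint.rec with
  | infty => exact ⟨fun ⟨_, _, h⟩ => absurd h (OnePoint.coe_ne_infty _),
      fun ⟨_, _, h⟩ => absurd h (OnePoint.coe_ne_infty _)⟩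
  | coe z =>
    rw [mem_preimage, d.projPoint_coe, coe_mem_closedDisk, d.affinePoint_X_sub_C,
      OnePoint.coe_injective.mem_set_image, mem_closedBall_iff_norm,
      Real.le_rpow_inv_iff_of_pos (norm_nonneg _) hs.le d.ε_pos]

theorem ArchStructure.preimage_openDisk (a : k) {s : ℝ} (hs : 0 < s) :
    d.projPoint ⁻¹' openDisk a s =
      ((↑) : ℂ → OnePoint ℂ) '' Metric.ball (d.σ a) (s ^ d.ε⁻¹) := by
  ext w
  induction w using OnePoint.rec with
  | infty => exact ⟨fun ⟨_, _, h⟩ => absurd h (OnePoint.coe_ne_infty _),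
      fun ⟨_, _, h⟩ => absurd h (OnePoint.coe_ne_infty _)⟩
  | coe z =>
    rw [mem_preimage, d.projPoint_coe, coe_mem_openDisk, d.affinePoint_X_sub_C,
      OnePoint.coe_injective.mem_set_image, mem_ball_iff_norm,
      Real.lt_rpow_inv_iff_of_pos (norm_nonneg _) hs.le d.ε_pos]

theorem exists_unit_direction (v : ℂ) : ∃ u : ℂ, ‖u‖ = 1 ∧ v = ‖v‖ * u := by
  rcases eq_or_ne v 0 with h0 | h0
  · exact ⟨1, by simp, by simp [h0]⟩
  · refine ⟨v / ‖v‖, by simp [h0], ?_⟩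
    have : (‖v‖ : ℂ) ≠ 0 := by simpa using h0
    field_simp

/-- Test the inclusion on the point of the smaller ball farthest from `a`, on the ray from `a`
through `b`. -/
theorem norm_sub_add_lt_of_closedBall_subset_ball {a b : ℂ} {R r : ℝ} (hr : 0 ≤ r)
    (h : Metric.closedBall b r ⊆ Metric.ball a R) : ‖a - b‖ + r < R := by
  obtain ⟨u, hu, hb⟩ := exists_unit_direction (b - a)
  have h1 : b + r * u ∈ Metric.closedBall b r := by
    rw [mem_closedBall_iff_norm, add_sub_cancel_left, norm_mul, hu, mul_one, Complex.norm_real,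
      Real.norm_eq_abs, abs_of_nonneg hr]
  have h2 := h h1
  have e : b + r * u - a = ((‖b - a‖ + r : ℝ) : ℂ) * u := by
    push_cast
    linear_combination hb
  rw [mem_ball_iff_norm, e, norm_mul, hu, mul_one, Complex.norm_real, Real.norm_eq_abs,
    abs_of_nonneg (by positivity)] at h2
  rwa [norm_sub_rev]

theorem ArchStructure.norm_map_sub (a b : k) : ‖d.σ a - d.σ b‖ = ‖a - b‖ ^ d.ε⁻¹ := by
  rw [← map_sub, d.norm_eq, Real.rpow_rpow_inv (norm_nonneg _) d.ε_pos.ne']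

theorem ArchStructure.preimage_of_cutOutAnnulus {a b : k} {R r : ℝ} (hR : 0 < R)
    (hr : 0 < r) {A : Set (ProjLineAn k)} (hA : CutOutAnnulus a R b r A) :
    let D := ((↑) : ℂ → OnePoint ℂ) '' Metric.closedBall (d.σ a) (R ^ d.ε⁻¹)
    let E := ((↑) : ℂ → OnePoint ℂ) '' Metric.closedBall (d.σ b) (r ^ d.ε⁻¹)
    let δ := ‖d.σ a - d.σ b‖
    (δ + r ^ d.ε⁻¹ < R ^ d.ε⁻¹ ∧ d.projPoint ⁻¹' A = D \ E) ∨
    (δ + R ^ d.ε⁻¹ < r ^ d.ε⁻¹ ∧ d.projPoint ⁻¹' A = E \ D) ∨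
    (R ^ d.ε⁻¹ + r ^ d.ε⁻¹ < δ ∧ d.projPoint ⁻¹' A = Dᶜ \ E) := by
  intro D E δ
  have hD : D = d.projPoint ⁻¹' closedDisk a R := (d.preimage_closedDisk a hR).symm
  have hE : E = d.projPoint ⁻¹' closedDisk b r := (d.preimage_closedDisk b hr).symm
  have key : ∀ {a b : k} {R r : ℝ}, 0 < R → 0 < r → closedDisk b r ⊆ openDisk a R →
      ‖d.σ a - d.σ b‖ + r ^ d.ε⁻¹ < R ^ d.ε⁻¹ := by
    intro a b R r hR hr h
    have h1 := preimage_mono (f := d.projPoint) h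
    rw [d.preimage_closedDisk b hr, d.preimage_openDisk a hR,
      image_subset_image_iff OnePoint.coe_injective] at h1
    exact norm_sub_add_lt_of_closedBall_subset_ball (by positivity) h1
  rcases hA with ⟨h1, rfl⟩ | ⟨h1, rfl⟩ | ⟨h1, rfl⟩
  · exact Or.inl ⟨key hR hr h1, by rw [hD, hE]; rfl⟩
  · refine Or.inr (Or.inl ⟨?_, by rw [hD, hE]; rfl⟩)
    have := key hr hR h1
    rwa [norm_sub_rev] at this
  · refine Or.inr (Or.inr ⟨?_, by rw [hD, hE]; rfl⟩)
    have h2 := h1.preimage d.projPoint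
    rw [d.preimage_closedDisk b hr, d.preimage_closedDisk a hR,
      disjoint_image_iff OnePoint.coe_injective,
      disjoint_closedBall_closedBall_iff (by positivity) (by positivity), dist_eq_norm] at h2
    exact h2

end ArchDisks

/-! ### Conformal rigidity of concentric annuli, on the logarithmic strip -/

section Rigidity

open Complex

/-- The open vertical strip `{0 < Re w < L}`. -/
def openStrip (L : ℝ) : Set ℂ := {w | 0 < w.re ∧ w.re < L}

theorem isOpen_openStrip (L : ℝ) : IsOpen (openStrip L) :=
  (isOpen_lt continuous_const continuous_re).inter (isOpen_lt continuous_re continuous_const)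

theorem convex_setOf_re_mem_Ioo (x y : ℝ) : Convex ℝ {w : ℂ | x < w.re ∧ w.re < y} :=
  (convex_halfSpace_re_gt x).inter (convex_halfSpace_re_lt y)

theorem ofReal_mem_openStrip {L x : ℝ} : (x : ℂ) ∈ openStrip L ↔ 0 < x ∧ x < L := Iff.rfl

theorem exists_int_im_add_mem_Icc (w : ℂ) :
    ∃ n : ℤ, 0 ≤ (w + n * (2 * Real.pi * I)).im ∧
      (w + n * (2 * Real.pi * I)).im ≤ 2 * Real.pi ∧ (w + n * (2 * Real.pi * I)).re = w.re := by
  have hp : 0 < 2 * Real.pi := by positivity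
  obtain ⟨n, hn, -⟩ := existsUnique_add_zsmul_mem_Ico hp w.im 0
  refine ⟨n, ?_, ?_, ?_⟩
  · have := hn.1
    simpa using this
  · have := hn.2.le
    simpa using this
  · simp

/-- Maximum principle on a strip for a periodic modulus with boundary values at most `1`. -/
theorem log_norm_nonpos_of_periodic {L : ℝ} {F : ℂ → ℂ} (hF : DifferentiableOn ℂ F (openStrip L))
    (h0 : ∀ w ∈ openStrip L, F w ≠ 0)
    (hper : ∀ w ∈ openStrip L, ∀ n : ℤ, ‖F (w + n * (2 * Real.pi * I))‖ = ‖F w‖)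
    (hbd : ∀ η : ℝ, 0 < η → ∃ δ : ℝ, 0 < δ ∧ ∀ w ∈ openStrip L,
      (w.re < δ ∨ L - δ < w.re) → Real.log ‖F w‖ < η) :
    ∀ w ∈ openStrip L, Real.log ‖F w‖ ≤ 0 := by
  intro w₀ hw₀
  by_contra! hη
  obtain ⟨δ, hδ, hδF⟩ := hbd _ hη
  -- `K` contains a period of the strip away from its edges. Near the edges `‖F‖` stays below `‖F
  -- w₀‖`, so the maximum over `K` is a maximum over the whole strip; `F` is then constant, against
  -- its small values near the edges.
  set K : Set ℂ := Icc δ (L - δ) ×ℂ Icc 0 (2 * Real.pi) with hK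
  have hKS : K ⊆ openStrip L := by
    intro w hw
    have hw1 := (mem_reProdIm.mp hw).1
    exact ⟨by linarith [hw1.1], by linarith [hw1.2]⟩
  have hKc : IsCompact K := isCompact_Icc.reProdIm isCompact_Icc
  have shift : ∀ w ∈ openStrip L, ¬(w.re < δ ∨ L - δ < w.re) → ∃ w' ∈ K, ‖F w'‖ = ‖F w‖ := by
    intro w hw hn
    push Not at hn
    obtain ⟨n, h1, h2, h3⟩ := exists_int_im_add_mem_Icc w
    exact ⟨_, mem_reProdIm.mpr ⟨by rw [h3]; exact hn, h1, h2⟩, hper w hw n⟩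
  obtain ⟨w₀', hw₀', e₀⟩ := shift w₀ hw₀ fun h => lt_irrefl _ (hδF w₀ hw₀ h)
  obtain ⟨w₁, hw₁, hmax⟩ := hKc.exists_isMaxOn ⟨w₀', hw₀'⟩
    (hF.continuousOn.mono hKS).norm
  have hle : ‖F w₀‖ ≤ ‖F w₁‖ := by rw [← e₀]; exact hmax hw₀'
  have hpos : ∀ w ∈ openStrip L, 0 < ‖F w‖ := fun w hw => norm_pos_iff.mpr (h0 w hw)
  have hmaxS : IsMaxOn (norm ∘ F) (openStrip L) w₁ := by
    intro w hw
    change ‖F w‖ ≤ ‖F w₁‖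
    by_cases hb : w.re < δ ∨ L - δ < w.re
    · have := hδF w hw hb
      exact ((Real.log_lt_log_iff (hpos w hw) (hpos w₀ hw₀)).mp this).le.trans hle
    · obtain ⟨w', hw', e⟩ := shift w hw hb
      rw [← e]
      exact hmax hw'
  have hconst := eqOn_of_isPreconnected_of_isMaxOn_norm
    (convex_setOf_re_mem_Ioo 0 L).isPreconnected (isOpen_openStrip L) hF (hKS hw₁) hmaxS
  have hL : 0 < L := hw₀.1.trans hw₀.2
  have hm : ((min δ L / 2 : ℝ) : ℂ) ∈ openStrip L := by
    rw [ofReal_mem_openStrip]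
    have := min_le_right δ L
    have := lt_min hδ hL
    constructor <;> linarith
  have h1 := hδF _ hm (Or.inl (by
    rw [ofReal_re]
    have := min_le_left δ L
    have := lt_min hδ hL
    linarith))
  rw [hconst hm] at h1
  have h2 := Real.log_le_log (hpos w₀ hw₀) hle
  exact absurd h1 (not_lt.mpr h2)

theorem eqOn_const_of_log_norm_eq_zero {L : ℝ} {F : ℂ → ℂ}
    (hF : DifferentiableOn ℂ F (openStrip L)) (h0 : ∀ w ∈ openStrip L, F w ≠ 0)
    (h1 : ∀ w ∈ openStrip L, Real.log ‖F w‖ = 0) {w₁ : ℂ} (hw₁ : w₁ ∈ openStrip L) :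
    ∀ w ∈ openStrip L, F w = F w₁ := by
  have hn : ∀ w ∈ openStrip L, ‖F w‖ = 1 := fun w hw =>
    Real.eq_one_of_pos_of_log_eq_zero (norm_pos_iff.mpr (h0 w hw)) (h1 w hw)
  refine eqOn_of_isPreconnected_of_isMaxOn_norm
    (convex_setOf_re_mem_Ioo 0 L).isPreconnected (isOpen_openStrip L) hF hw₁ ?_
  intro w hw
  change ‖F w‖ ≤ ‖F w₁‖
  rw [hn w hw, hn w₁ hw₁]

theorem add_mem_openStrip {L : ℝ} {w v : ℂ} (hw : w ∈ openStrip L) (hv : v.re = 0) :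
    w + v ∈ openStrip L := by
  simpa [openStrip, hv] using hw

/-- A holomorphic function `H = h ∘ exp` on a strip, with `h` injective, whose modulus tends to
`1` at the left end and to `e ^ M` at the right end: the width of the strip is `M`. -/
theorem strip_width_eq_of_boundary {L M : ℝ} (hL : 0 < L) (hM : 0 < M) {H : ℂ → ℂ}
    (hH : DifferentiableOn ℂ H (openStrip L)) (h0 : ∀ w ∈ openStrip L, H w ≠ 0)
    (hinj : ∀ w ∈ openStrip L, ∀ w' ∈ openStrip L, H w = H w' ↔ exp w = exp w')
    (hl : ∀ η : ℝ, 0 < η → ∃ δ : ℝ, 0 < δ ∧ ∀ w ∈ openStrip L, w.re < δ →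
      |Real.log ‖H w‖| < η)
    (hr : ∀ η : ℝ, 0 < η → ∃ δ : ℝ, 0 < δ ∧ ∀ w ∈ openStrip L, L - δ < w.re →
      |Real.log ‖H w‖ - M| < η) : L = M := by
  -- With this slope, `F w = H w * exp (-c w)` has modulus tending to `1` at both edges. The maximum
  -- principle for `F` and for `1 / F` shows that `F` is constant, so `H` is a multiple of `exp (c
  -- w)`.
  set c : ℝ := M / L with hc
  have hcpos : 0 < c := by positivity
  have hcL : c * L = M := by rw [hc]; field_simp
  have hlogF : ∀ w ∈ openStrip L,
      Real.log ‖H w * exp (-(c * w))‖ = Real.log ‖H w‖ - c * w.re := by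
    intro w hw
    rw [norm_mul, Real.log_mul (norm_ne_zero_iff.mpr (h0 w hw))
      (norm_ne_zero_iff.mpr (exp_ne_zero _)), norm_exp, Real.log_exp]
    simp; ring
  set F : ℂ → ℂ := fun w => H w * exp (-(c * w)) with hFdef
  have hFne : ∀ w ∈ openStrip L, F w ≠ 0 := fun w hw => mul_ne_zero (h0 w hw) (exp_ne_zero _)
  have hFd : DifferentiableOn ℂ F (openStrip L) := by
    refine hH.mul ?_
    exact Differentiable.differentiableOn (by fun_prop)
  have hre : ∀ n : ℤ, (n * (2 * Real.pi * I) : ℂ).re = 0 := by intro n; simp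
  have hHper : ∀ w ∈ openStrip L, ∀ n : ℤ, H (w + n * (2 * Real.pi * I)) = H w := by
    intro w hw n
    refine (hinj _ (add_mem_openStrip hw (hre n)) _ hw).mpr ?_
    exact exp_eq_exp_iff_exists_int.mpr ⟨n, rfl⟩
  have hFper : ∀ w ∈ openStrip L, ∀ n : ℤ, ‖F (w + n * (2 * Real.pi * I))‖ = ‖F w‖ := by
    intro w hw n
    simp only [hFdef]
    rw [norm_mul, norm_mul, hHper w hw n, norm_exp, norm_exp]
    simp
  have hbd : ∀ η : ℝ, 0 < η → ∃ δ : ℝ, 0 < δ ∧ ∀ w ∈ openStrip L,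
      (w.re < δ ∨ L - δ < w.re) → |Real.log ‖F w‖| < η := by
    intro η hη
    obtain ⟨δ₁, hδ₁, H₁⟩ := hl (η / 2) (by positivity)
    obtain ⟨δ₂, hδ₂, H₂⟩ := hr (η / 2) (by positivity)
    refine ⟨min (min δ₁ δ₂) (η / (2 * c)), by positivity, ?_⟩
    have e1 : min (min δ₁ δ₂) (η / (2 * c)) ≤ δ₁ := (min_le_left _ _).trans (min_le_left _ _)
    have e2 : min (min δ₁ δ₂) (η / (2 * c)) ≤ δ₂ := (min_le_left _ _).trans (min_le_right _ _)
    have e3 : min (min δ₁ δ₂) (η / (2 * c)) ≤ η / (2 * c) := min_le_right _ _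
    have e4 : c * (η / (2 * c)) = η / 2 := by field_simp
    intro w hw hor
    rw [hlogF w hw]
    rcases hor with h | h
    · have a1 := abs_lt.mp (H₁ w hw (h.trans_le e1))
      have a2 : c * w.re < η / 2 := by
        rw [← e4]; exact mul_lt_mul_of_pos_left (h.trans_le e3) hcpos
      have a3 : 0 < c * w.re := mul_pos hcpos hw.1
      rw [abs_lt]
      constructor <;> linarith
    · have a1 := abs_lt.mp (H₂ w hw (by linarith))
      have a2 : c * (L - w.re) < η / 2 := by
        rw [← e4]; exact mul_lt_mul_of_pos_left (by linarith) hcpos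
      have a3 : 0 < c * (L - w.re) := mul_pos hcpos (by linarith [hw.2])
      have a4 : c * (L - w.re) = M - c * w.re := by rw [mul_sub, hcL]
      rw [abs_lt]
      constructor <;> linarith
  have hup := log_norm_nonpos_of_periodic hFd hFne hFper (fun η hη => by
    obtain ⟨δ, hδ, h⟩ := hbd η hη
    exact ⟨δ, hδ, fun w hw hor => (abs_lt.mp (h w hw hor)).2⟩)
  have hlow := log_norm_nonpos_of_periodic (F := fun w => (F w)⁻¹) (hFd.inv hFne)
    (fun w hw => inv_ne_zero (hFne w hw))
    (fun w hw n => by rw [norm_inv, norm_inv, hFper w hw n]) (fun η hη => by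
    obtain ⟨δ, hδ, h⟩ := hbd η hη
    refine ⟨δ, hδ, fun w hw hor => ?_⟩
    rw [norm_inv, Real.log_inv]
    linarith [(abs_lt.mp (h w hw hor)).1])
  have hzero : ∀ w ∈ openStrip L, Real.log ‖F w‖ = 0 := by
    intro w hw
    have := hlow w hw
    rw [norm_inv, Real.log_inv] at this
    exact le_antisymm (hup w hw) (by linarith)
  set w₁ : ℂ := ((L / 2 : ℝ) : ℂ)
  have hw₁ : w₁ ∈ openStrip L := ofReal_mem_openStrip.mpr ⟨by linarith, by linarith⟩
  have hconst := eqOn_const_of_log_norm_eq_zero hFd hFne hzero hw₁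
  -- `H` identifies exactly the points that `exp` identifies, so `exp w` and `exp (c w)` have the
  -- same periods. Thus `c` and `1 / c` are both positive integers, and `c = 1`.
  have key : ∀ v : ℂ, v.re = 0 → (exp v = 1 ↔ exp (c * v) = 1) := by
    intro v hv
    have hwv := add_mem_openStrip hw₁ hv
    have e1 : H (w₁ + v) = H w₁ * exp (c * v) := by
      have := hconst _ hwv
      simp only [hFdef] at this
      rw [mul_add, neg_add, exp_add, ← mul_assoc, mul_right_comm] at this
      have := mul_right_cancel₀ (exp_ne_zero _) this
      rw [← this, mul_assoc, ← exp_add, neg_add_cancel, exp_zero, mul_one]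
    have e2 := hinj _ hwv _ hw₁
    rw [e1, exp_add, mul_eq_left₀ (h0 _ hw₁), mul_eq_left₀ (exp_ne_zero _)] at e2
    exact e2.symm
  have hpi : (2 * Real.pi * I : ℂ) ≠ 0 := two_pi_I_ne_zero
  obtain ⟨m, hm⟩ := exp_eq_one_iff.mp ((key (2 * Real.pi * I) (by simp)).mp exp_two_pi_mul_I)
  have hm' : (c : ℂ) = m := mul_right_cancel₀ hpi hm
  have hcc : (c : ℂ) ≠ 0 := ofReal_ne_zero.mpr hcpos.ne'
  obtain ⟨j, hj⟩ := exp_eq_one_iff.mp ((key (2 * Real.pi * I / c) (by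
    rw [div_ofReal_re]; simp)).mpr (by
      rw [mul_div_cancel₀ _ hcc]; exact exp_two_pi_mul_I))
  have hj' : (1 : ℂ) = j * c := by
    rw [div_eq_iff hcc] at hj
    apply mul_right_cancel₀ hpi
    linear_combination hj
  have hm'' : c = (m : ℝ) := by exact_mod_cast hm'
  have hj'' : (1 : ℝ) = j * c := by exact_mod_cast hj'
  have hmpos : 0 < m := by rw [hm''] at hcpos; exact_mod_cast hcpos
  have hjm : j * m = 1 := by
    rw [hm''] at hj''
    exact_mod_cast hj''.symm
  have hm1 : m = 1 := Int.eq_one_of_dvd_one hmpos.le ⟨j, by rw [mul_comm]; exact hjm.symm⟩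
  rw [hm'', hm1] at hcL
  push_cast at hcL
  linarith

/-- Properness of the inverse map: the images of narrower strips form a directed open cover of `K`,
so one of them covers `K`. Injectivity modulo periods carries this back to every preimage, because
`exp w` determines `w.re`. -/
theorem exists_strip_margin_of_isCompact {L : ℝ} {H : ℂ → ℂ}
    (hopen : ∀ s ⊆ openStrip L, IsOpen s → IsOpen (H '' s))
    (hinj : ∀ w ∈ openStrip L, ∀ w' ∈ openStrip L, H w = H w' → exp w = exp w')
    {K : Set ℂ} (hK : IsCompact K) (hKsub : K ⊆ H '' openStrip L) :
    ∃ δ : ℝ, 0 < δ ∧ ∀ w ∈ openStrip L, H w ∈ K → δ < w.re ∧ w.re < L - δ := by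
  let U : Ioi (0 : ℝ) → Set ℂ := fun δ => {w | δ.1 < w.re ∧ w.re < L - δ.1}
  have hU : ∀ δ, U δ ⊆ openStrip L := fun δ w hw => by
    have h1 := δ.2
    exact ⟨lt_trans h1 hw.1, hw.2.trans (by linarith [mem_Ioi.mp h1])⟩
  have hUo : ∀ δ, IsOpen (U δ) := fun δ =>
    (isOpen_lt continuous_const continuous_re).inter (isOpen_lt continuous_re continuous_const)
  have : Nonempty (Ioi (0 : ℝ)) := ⟨⟨1, mem_Ioi.mpr one_pos⟩⟩
  obtain ⟨δ, hδ⟩ := hK.elim_directed_cover (fun δ => H '' U δ)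
    (fun δ => hopen _ (hU δ) (hUo δ)) (by
      rintro z hz
      obtain ⟨w, hw, rfl⟩ := hKsub hz
      have hp : 0 < min w.re (L - w.re) := lt_min hw.1 (by linarith [hw.2])
      refine mem_iUnion.mpr ⟨⟨min w.re (L - w.re) / 2, by simpa using hp⟩, w, ⟨?_, ?_⟩, rfl⟩
      · have := min_le_left w.re (L - w.re)
        change min w.re (L - w.re) / 2 < _
        linarith
      · have := min_le_right w.re (L - w.re)
        change _ < L - min w.re (L - w.re) / 2
        linarith) (by
      intro a b
      refine ⟨⟨min a.1 b.1, mem_Ioi.mpr (lt_min (mem_Ioi.mp a.2) (mem_Ioi.mp b.2))⟩, image_mono ?_, image_mono ?_⟩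
      · intro w hw
        have := min_le_left a.1 b.1
        exact ⟨lt_of_le_of_lt this hw.1, hw.2.trans_le (by
          change L - a.1 ≤ L - min a.1 b.1
          linarith)⟩
      · intro w hw
        have := min_le_right a.1 b.1
        exact ⟨lt_of_le_of_lt this hw.1, hw.2.trans_le (by
          change L - b.1 ≤ L - min a.1 b.1
          linarith)⟩)
  refine ⟨δ.1, δ.2, fun w hw hHw => ?_⟩
  obtain ⟨w', hw', e⟩ := hδ hHw
  have h1 := hinj w' (hU δ hw') w hw e
  have h2 : w'.re = w.re := by
    have := congrArg norm h1
    rwa [norm_exp, norm_exp, Real.exp_eq_exp] at this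
  rw [← h2]
  exact hw'

end Rigidity

section Rigidity

open Complex

/-- Close to the edge `ρ = 0`, `ℓ` avoids any given compact part of `(0, M)`. As the region near the
edge is connected, `ℓ` stays on one side of `M / 2` there, and hence tends to `0` or to `M`. -/
theorem boundary_value_dichotomy {S : Set ℂ} {M : ℝ} (hM : 0 < M) {ℓ ρ : ℂ → ℝ}
    (hℓ : ContinuousOn ℓ S) (hmem : ∀ w ∈ S, 0 < ℓ w ∧ ℓ w < M)
    (hmargin : ∀ x y : ℝ, 0 < x → y < M → ∃ δ : ℝ, 0 < δ ∧ ∀ w ∈ S, x ≤ ℓ w → ℓ w ≤ y → δ < ρ w)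
    (hpre : ∀ δ, IsPreconnected {w | w ∈ S ∧ ρ w < δ}) :
    (∀ η : ℝ, 0 < η → ∃ δ : ℝ, 0 < δ ∧ ∀ w ∈ S, ρ w < δ → |ℓ w| < η) ∨
    (∀ η : ℝ, 0 < η → ∃ δ : ℝ, 0 < δ ∧ ∀ w ∈ S, ρ w < δ → |ℓ w - M| < η) := by
  obtain ⟨δ₀, hδ₀, h₀⟩ := hmargin (M / 2) (M / 2) (by linarith) (by linarith)
  have hside : (∀ w ∈ S, ρ w < δ₀ → ℓ w < M / 2) ∨ (∀ w ∈ S, ρ w < δ₀ → M / 2 < ℓ w) := by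
    by_contra! hcon
    obtain ⟨⟨a, ha, ha', ha''⟩, ⟨b, hb, hb', hb''⟩⟩ := hcon
    obtain ⟨w, ⟨hw, hw'⟩, e⟩ := (hpre δ₀).intermediate_value (a := b) (b := a) ⟨hb, hb'⟩ ⟨ha, ha'⟩
      (hℓ.mono fun _ h => h.1) ⟨hb'', ha''⟩
    exact lt_asymm hw' (h₀ w hw e.ge e.le)
  rcases hside with h | h
  · refine Or.inl fun η hη => ?_
    obtain ⟨δ, hδ, h₁⟩ := hmargin (min η (M / 2)) (M / 2) (lt_min hη (by linarith)) (by linarith)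
    refine ⟨min δ δ₀, lt_min hδ hδ₀, fun w hw hwρ => ?_⟩
    rw [abs_of_pos (hmem w hw).1]
    by_contra! hle
    exact lt_asymm (hwρ.trans_le (min_le_left _ _)) (h₁ w hw ((min_le_left _ _).trans hle)
      (h w hw (hwρ.trans_le (min_le_right _ _))).le)
  · refine Or.inr fun η hη => ?_
    obtain ⟨δ, hδ, h₁⟩ := hmargin (M / 2) (M - η) (by linarith) (by linarith)
    refine ⟨min δ δ₀, lt_min hδ hδ₀, fun w hw hwρ => ?_⟩
    rw [abs_sub_comm, abs_of_pos (by linarith [(hmem w hw).2])]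
    by_contra! hle
    exact lt_asymm (hwρ.trans_le (min_le_left _ _)) (h₁ w hw
      (h w hw (hwρ.trans_le (min_le_right _ _))).le (by linarith))

theorem exp_mem_annulus_iff {L : ℝ} {w : ℂ} :
    (1 < ‖exp w‖ ∧ ‖exp w‖ < Real.exp L) ↔ w ∈ openStrip L := by
  rw [norm_exp, Real.exp_lt_exp, Real.one_lt_exp_iff]
  rfl

theorem exists_exp_eq_of_mem_annulus {L : ℝ} {z : ℂ} (hz : 1 < ‖z‖ ∧ ‖z‖ < Real.exp L) :
    ∃ w ∈ openStrip L, exp w = z := by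
  have h0 : z ≠ 0 := norm_pos_iff.mp (by linarith [hz.1])
  exact ⟨log z, exp_mem_annulus_iff.mp (by rwa [exp_log h0]), exp_log h0⟩

/-- Concentric annuli of different moduli are not conformally equivalent. -/
theorem eq_of_bijOn_annulus {L M : ℝ} (hL : 0 < L) (hM : 0 < M) {g : ℂ → ℂ}
    (hg : DifferentiableOn ℂ g {z : ℂ | 1 < ‖z‖ ∧ ‖z‖ < Real.exp L})
    (hbij : BijOn g {z : ℂ | 1 < ‖z‖ ∧ ‖z‖ < Real.exp L} {z : ℂ | 1 < ‖z‖ ∧ ‖z‖ < Real.exp M}) :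
    L = M := by
  set S := openStrip L with hS
  set H : ℂ → ℂ := fun w => g (exp w) with hHdef
  have hmaps : MapsTo exp S {z : ℂ | 1 < ‖z‖ ∧ ‖z‖ < Real.exp L} :=
    fun w hw => exp_mem_annulus_iff.mpr hw
  have hH : DifferentiableOn ℂ H S := hg.comp differentiable_exp.differentiableOn hmaps
  have hHmem : ∀ w ∈ S, 1 < ‖H w‖ ∧ ‖H w‖ < Real.exp M := fun w hw => hbij.mapsTo (hmaps hw)
  have h0 : ∀ w ∈ S, H w ≠ 0 := fun w hw => norm_pos_iff.mp (by linarith [(hHmem w hw).1])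
  have hinj : ∀ w ∈ S, ∀ w' ∈ S, H w = H w' ↔ exp w = exp w' := fun w hw w' hw' =>
    ⟨fun h => hbij.injOn (hmaps hw) (hmaps hw') h, fun h => congrArg g h⟩
  have hsurj : ∀ z : ℂ, 1 < ‖z‖ → ‖z‖ < Real.exp M → z ∈ H '' S := by
    intro z h1 h2
    obtain ⟨u, hu, rfl⟩ := hbij.surjOn ⟨h1, h2⟩
    obtain ⟨w, hw, rfl⟩ := exists_exp_eq_of_mem_annulus hu
    exact ⟨w, hw, rfl⟩
  have hopen : ∀ s ⊆ S, IsOpen s → IsOpen (H '' s) := by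
    refine ((hH.analyticOnNhd (isOpen_openStrip L)).is_constant_or_isOpen
      (convex_setOf_re_mem_Ioo 0 L).isPreconnected).resolve_left ?_
    rintro ⟨c, hc⟩
    have m1 : ((L / 2 : ℝ) : ℂ) ∈ S := ofReal_mem_openStrip.mpr ⟨by linarith, by linarith⟩
    have m2 : ((L / 3 : ℝ) : ℂ) ∈ S := ofReal_mem_openStrip.mpr ⟨by linarith, by linarith⟩
    have e := (hinj _ m1 _ m2).mp ((hc _ m1).trans (hc _ m2).symm)
    have := congrArg norm e
    rw [norm_exp, norm_exp, Real.exp_eq_exp, ofReal_re, ofReal_re] at this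
    linarith
  set ℓ : ℂ → ℝ := fun w => Real.log ‖H w‖ with hℓdef
  have hexp : ∀ w ∈ S, Real.exp (ℓ w) = ‖H w‖ := fun w hw =>
    Real.exp_log (norm_pos_iff.mpr (h0 w hw))
  have hℓ : ContinuousOn ℓ S :=
    hH.continuousOn.norm.log fun w hw => norm_ne_zero_iff.mpr (h0 w hw)
  have hmem : ∀ w ∈ S, 0 < ℓ w ∧ ℓ w < M := fun w hw =>
    ⟨Real.log_pos (hHmem w hw).1, by
      rw [← Real.exp_lt_exp, hexp w hw]; exact (hHmem w hw).2⟩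
  have hmargin : ∀ x y : ℝ, 0 < x → y < M → ∃ δ : ℝ, 0 < δ ∧ ∀ w ∈ S, x ≤ ℓ w → ℓ w ≤ y →
      δ < w.re ∧ w.re < L - δ := by
    intro x y hx hy
    set K : Set ℂ := {z | Real.exp x ≤ ‖z‖ ∧ ‖z‖ ≤ Real.exp y} with hK
    have hKc : IsCompact K := by
      refine Metric.isCompact_of_isClosed_isBounded
        ((isClosed_le continuous_const continuous_norm).inter
          (isClosed_le continuous_norm continuous_const)) ?_
      refine Metric.isBounded_closedBall (x := (0 : ℂ)) (r := Real.exp y) |>.subset ?_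
      intro z hz
      simpa using hz.2
    obtain ⟨δ, hδ, h⟩ := exists_strip_margin_of_isCompact hopen
      (fun w hw w' hw' => (hinj w hw w' hw').mp) hKc (fun z hz => hsurj z
        ((Real.one_lt_exp_iff.mpr hx).trans_le hz.1) (hz.2.trans_lt (Real.exp_lt_exp.mpr hy)))
    refine ⟨δ, hδ, fun w hw h1 h2 => h w hw ⟨?_, ?_⟩⟩
    · rw [← hexp w hw]; exact Real.exp_le_exp.mpr h1
    · rw [← hexp w hw]; exact Real.exp_le_exp.mpr h2
  have hleft := boundary_value_dichotomy hM (ρ := fun w => w.re) hℓ hmem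
    (fun x y hx hy => by
      obtain ⟨δ, hδ, h⟩ := hmargin x y hx hy
      exact ⟨δ, hδ, fun w hw h1 h2 => (h w hw h1 h2).1⟩)
    (fun δ => ((convex_setOf_re_mem_Ioo 0 L).inter (convex_halfSpace_re_lt δ)).isPreconnected)
  have hright := boundary_value_dichotomy hM (ρ := fun w => L - w.re) hℓ hmem
    (fun x y hx hy => by
      obtain ⟨δ, hδ, h⟩ := hmargin x y hx hy
      exact ⟨δ, hδ, fun w hw h1 h2 => by linarith [(h w hw h1 h2).2]⟩)
    (fun δ => by
      have : {w | w ∈ S ∧ L - w.re < δ} = S ∩ {w | L - δ < w.re} := by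
        ext w
        exact and_congr_right fun _ => sub_lt_comm
      rw [this]
      exact ((convex_setOf_re_mem_Ioo 0 L).inter (convex_halfSpace_re_gt (L - δ))).isPreconnected)
  have hright' : (∀ η : ℝ, 0 < η → ∃ δ : ℝ, 0 < δ ∧ ∀ w ∈ S, L - δ < w.re → |ℓ w| < η) ∨
      (∀ η : ℝ, 0 < η → ∃ δ : ℝ, 0 < δ ∧ ∀ w ∈ S, L - δ < w.re → |ℓ w - M| < η) := by
    simpa only [sub_lt_comm] using hright
  have hw₁ : ((L / 2 : ℝ) : ℂ) ∈ S := ofReal_mem_openStrip.mpr ⟨by linarith, by linarith⟩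
  have hper : ∀ w ∈ S, ∀ n : ℤ, H (w + n * (2 * Real.pi * I)) = H w := by
    intro w hw n
    exact congrArg g (exp_eq_exp_iff_exists_int.mpr ⟨n, rfl⟩)
  have hlogdiv : ∀ w ∈ S, Real.log ‖exp M / H w‖ = M - ℓ w := by
    intro w hw
    rw [norm_div, Real.log_div (norm_ne_zero_iff.mpr (exp_ne_zero _))
      (norm_ne_zero_iff.mpr (h0 w hw)), norm_exp, Real.log_exp, ofReal_re]
  have hdivd : DifferentiableOn ℂ (fun w => exp M / H w) S :=
    (differentiableOn_const _).div hH h0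
  have hdiv0 : ∀ w ∈ S, exp M / H w ≠ 0 := fun w hw => div_ne_zero (exp_ne_zero _) (h0 w hw)
  -- Equal limits at both edges contradict the maximum principle, for `H` or for `exp M / H`. If the
  -- edges are exchanged, `exp M / H` puts them back in order.
  rcases hleft with hl | hl <;> rcases hright' with hr | hr
  · exfalso
    have := log_norm_nonpos_of_periodic hH h0 (fun w hw n => by rw [hper w hw n]) (fun η hη => by
      obtain ⟨δ₁, hδ₁, H₁⟩ := hl η hη
      obtain ⟨δ₂, hδ₂, H₂⟩ := hr η hη
      refine ⟨min δ₁ δ₂, lt_min hδ₁ hδ₂, fun w hw hor => ?_⟩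
      have e1 := min_le_left δ₁ δ₂
      have e2 := min_le_right δ₁ δ₂
      rcases hor with h | h
      · exact (le_abs_self _).trans_lt (H₁ w hw (by linarith))
      · exact (le_abs_self _).trans_lt (H₂ w hw (by linarith))) _ hw₁
    exact absurd (hmem _ hw₁).1 (not_lt.mpr this)
  · exact strip_width_eq_of_boundary hL hM hH h0 hinj hl hr
  · refine strip_width_eq_of_boundary hL hM hdivd hdiv0 ?_ ?_ ?_
    · intro w hw w' hw'
      rw [← hinj w hw w' hw', div_eq_div_iff (h0 w hw) (h0 w' hw'),
        mul_right_inj' (exp_ne_zero _), eq_comm]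
    · intro η hη
      obtain ⟨δ, hδ, h⟩ := hl η hη
      refine ⟨δ, hδ, fun w hw hlt => ?_⟩
      rw [hlogdiv w hw, abs_sub_comm]
      exact h w hw hlt
    · intro η hη
      obtain ⟨δ, hδ, h⟩ := hr η hη
      refine ⟨δ, hδ, fun w hw hlt => ?_⟩
      rw [hlogdiv w hw, sub_sub_cancel_left, abs_neg]
      exact h w hw hlt
  · exfalso
    have := log_norm_nonpos_of_periodic hdivd hdiv0 (fun w hw n => by rw [hper w hw n])
      (fun η hη => by
      obtain ⟨δ₁, hδ₁, H₁⟩ := hl η hη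
      obtain ⟨δ₂, hδ₂, H₂⟩ := hr η hη
      refine ⟨min δ₁ δ₂, lt_min hδ₁ hδ₂, fun w hw hor => ?_⟩
      have e1 := min_le_left δ₁ δ₂
      have e2 := min_le_right δ₁ δ₂
      rw [hlogdiv w hw]
      rcases hor with h | h
      · have := (abs_lt.mp (H₁ w hw (by linarith))).1
        linarith
      · have := (abs_lt.mp (H₂ w hw (by linarith))).1
        linarith) _ hw₁
    rw [hlogdiv _ hw₁] at this
    linarith [(hmem _ hw₁).2]

end Rigidity

/-! ### The Riemann sphere in homogeneous coordinates and Möbius invariance -/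

section Sphere

/-- The point `[X : Y]` of the Riemann sphere. -/
noncomputable def spherePoint (X Y : ℂ) : OnePoint ℂ :=
  if Y = 0 then OnePoint.infty else ((X / Y : ℂ) : OnePoint ℂ)

theorem spherePoint_zero_right (X : ℂ) : spherePoint X 0 = OnePoint.infty := if_pos rfl

theorem spherePoint_of_ne {X Y : ℂ} (h : Y ≠ 0) :
    spherePoint X Y = ((X / Y : ℂ) : OnePoint ℂ) := if_neg h

theorem sphereCoord_coe (z : ℂ) : sphereCoord (z : OnePoint ℂ) = z := rfl

theorem sphereCoord_infty : sphereCoord OnePoint.infty = 0 := rfl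

theorem coe_sphereCoord {p : OnePoint ℂ} (h : p ≠ OnePoint.infty) :
    ((sphereCoord p : ℂ) : OnePoint ℂ) = p := by
  obtain ⟨z, rfl⟩ := OnePoint.ne_infty_iff_exists.mp h
  rfl

theorem sphereCoord_spherePoint (X Y : ℂ) : sphereCoord (spherePoint X Y) = X / Y := by
  by_cases h : Y = 0
  · rw [h, spherePoint_zero_right, sphereCoord_infty, div_zero]
  · rw [spherePoint_of_ne h, sphereCoord_coe]

theorem tendsto_spherePoint_one_zero :
    Tendsto (fun y : ℂ => spherePoint 1 y) (𝓝 0) (𝓝 OnePoint.infty) := by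
  rw [OnePoint.hasBasis_nhds_infty.tendsto_right_iff]
  rintro s ⟨-, hs⟩
  obtain ⟨C, hC⟩ := hs.isBounded.exists_norm_le
  have hC' : 0 < max C 0 + 1 := by positivity
  filter_upwards [Metric.ball_mem_nhds (0 : ℂ) (inv_pos.mpr hC')] with y hy
  rw [mem_ball_zero_iff] at hy
  by_cases h : y = 0
  · rw [h, spherePoint_zero_right]; exact Or.inr rfl
  · rw [spherePoint_of_ne h]
    refine Or.inl ⟨1 / y, fun hmem => ?_, rfl⟩
    have h1 := hC _ hmem
    rw [norm_div, norm_one, one_div] at h1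
    have h2 : max C 0 + 1 < ‖y‖⁻¹ := (lt_inv_comm₀ hC' (norm_pos_iff.mpr h)).mpr hy
    linarith [le_max_left C 0]

theorem spherePoint_eq_one_div {X Y : ℂ} (hX : X ≠ 0) : spherePoint X Y = spherePoint 1 (Y / X) := by
  by_cases h : Y = 0
  · rw [h, zero_div, spherePoint_zero_right, spherePoint_zero_right]
  · rw [spherePoint_of_ne h, spherePoint_of_ne (div_ne_zero h hX), one_div_div]

/-- A map given near `z` by homogeneous coordinates that are differentiable is continuous at `z`
and holomorphic in the two charts. -/
theorem holomorphicAt_of_homogeneous {f : ℂ → OnePoint ℂ} {X Y : ℂ → ℂ} {z : ℂ}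
    (hX : DifferentiableAt ℂ X z) (hY : DifferentiableAt ℂ Y z)
    (hXY : X z ≠ 0 ∨ Y z ≠ 0) (hf : f =ᶠ[𝓝 z] fun w => spherePoint (X w) (Y w)) :
    ContinuousAt f z ∧
    (f z ≠ OnePoint.infty → DifferentiableAt ℂ (fun w => sphereCoord (f w)) z) ∧
    (f z ≠ ((0 : ℂ) : OnePoint ℂ) → DifferentiableAt ℂ (fun w => (sphereCoord (f w))⁻¹) z) := by
  have hc : (fun w => sphereCoord (f w)) =ᶠ[𝓝 z] fun w => X w / Y w := by
    filter_upwards [hf] with w hw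
    rw [hw, sphereCoord_spherePoint]
  have hci : (fun w => (sphereCoord (f w))⁻¹) =ᶠ[𝓝 z] fun w => Y w / X w := by
    filter_upwards [hc] with w hw
    rw [hw, inv_div]
  have hfz : f z = spherePoint (X z) (Y z) := hf.self_of_nhds
  have hXdiv : X z ≠ 0 → DifferentiableAt ℂ (fun w => (sphereCoord (f w))⁻¹) z := fun h =>
    (hY.div hX h).congr_of_eventuallyEq hci
  have hYdiv : Y z ≠ 0 → DifferentiableAt ℂ (fun w => sphereCoord (f w)) z := fun h =>
    (hX.div hY h).congr_of_eventuallyEq hc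
  refine ⟨?_, fun h => hYdiv ?_, fun h => hXdiv ?_⟩
  · refine ContinuousAt.congr ?_ hf.symm
    by_cases hYz : Y z = 0
    · have hXz : X z ≠ 0 := hXY.resolve_right (not_not.mpr hYz)
      have h1 : (fun w => spherePoint (X w) (Y w)) =ᶠ[𝓝 z] fun w => spherePoint 1 (Y w / X w) := by
        filter_upwards [hX.continuousAt.eventually_ne hXz] with w hw
        exact spherePoint_eq_one_div hw
      refine ContinuousAt.congr ?_ h1.symm
      have h2 : Tendsto (fun w => Y w / X w) (𝓝 z) (𝓝 0) := by
        have := hY.continuousAt.tendsto.div hX.continuousAt.tendsto hXz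
        rwa [hYz, zero_div] at this
      have h3 := tendsto_spherePoint_one_zero.comp h2
      unfold ContinuousAt
      simp only [hYz, zero_div, spherePoint_zero_right]
      exact h3
    · have h1 : (fun w => spherePoint (X w) (Y w)) =ᶠ[𝓝 z]
          fun w => ((X w / Y w : ℂ) : OnePoint ℂ) := by
        filter_upwards [hY.continuousAt.eventually_ne hYz] with w hw
        exact spherePoint_of_ne hw
      refine ContinuousAt.congr ?_ h1.symm
      exact OnePoint.continuous_coe.continuousAt.comp (hX.continuousAt.div hY.continuousAt hYz)
  · intro hYz
    rw [hfz, hYz, spherePoint_zero_right] at h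
    exact h rfl
  · intro hXz
    rw [hfz, hXz, spherePoint_of_ne (hXY.resolve_left (not_not.mpr hXz)), zero_div] at h
    exact h rfl

/-- Take `[f : 1]` away from `∞` and `[1 : 1 / f]` near `∞`. The conventions `sphereCoord ∞ = 0` and
`0⁻¹ = 0` give the second chart its correct value at `∞`. -/
theorem IsHolomorphicToSphere.exists_homogeneous {f : ℂ → OnePoint ℂ} {U : Set ℂ}
    (hf : IsHolomorphicToSphere f U) (hU : IsOpen U) {z : ℂ} (hz : z ∈ U) :
    ∃ X Y : ℂ → ℂ, DifferentiableAt ℂ X z ∧ DifferentiableAt ℂ Y z ∧ (X z ≠ 0 ∨ Y z ≠ 0) ∧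
      f =ᶠ[𝓝 z] fun w => spherePoint (X w) (Y w) := by
  have hc : ContinuousAt f z := hf.1.continuousAt (hU.mem_nhds hz)
  by_cases h : f z = OnePoint.infty
  · have h0 : f z ≠ ((0 : ℂ) : OnePoint ℂ) := by rw [h]; exact OnePoint.infty_ne_coe _
    refine ⟨fun _ => 1, fun w => (sphereCoord (f w))⁻¹, differentiableAt_const _,
      (hf.2 z hz).2 h0, Or.inl one_ne_zero, ?_⟩
    filter_upwards [hc.eventually_ne h0] with w hw
    by_cases hw' : f w = OnePoint.infty
    · rw [hw', sphereCoord_infty, inv_zero, spherePoint_zero_right]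
    · have hs : sphereCoord (f w) ≠ 0 := by
        intro h1
        rw [← coe_sphereCoord hw', h1] at hw
        exact hw rfl
      rw [spherePoint_of_ne (inv_ne_zero hs), one_div, inv_inv, coe_sphereCoord hw']
  · refine ⟨fun w => sphereCoord (f w), fun _ => 1, (hf.2 z hz).1 h, differentiableAt_const _,
      Or.inr one_ne_zero, ?_⟩
    filter_upwards [hc.eventually_ne h] with w hw
    rw [spherePoint_of_ne one_ne_zero, div_one, coe_sphereCoord hw]

open OnePoint Matrix in
theorem smul_spherePoint (g : GL (Fin 2) ℂ) {X Y : ℂ} (h : X ≠ 0 ∨ Y ≠ 0) :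
    g • spherePoint X Y = spherePoint (g 0 0 * X + g 0 1 * Y) (g 1 0 * X + g 1 1 * Y) := by
  by_cases hY : Y = 0
  · have hX : X ≠ 0 := h.resolve_right (not_not.mpr hY)
    rw [hY, spherePoint_zero_right, OnePoint.smul_infty_eq_ite]
    simp only [mul_zero, add_zero]
    by_cases hg : g 1 0 = 0
    · rw [if_pos hg, hg, zero_mul, spherePoint_zero_right]
    · rw [if_neg hg, spherePoint_of_ne (mul_ne_zero hg hX), mul_div_mul_right _ _ hX]
  · rw [spherePoint_of_ne hY, OnePoint.smul_some_eq_ite]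
    have e : g 1 0 * (X / Y) + g 1 1 = (g 1 0 * X + g 1 1 * Y) / Y := by field_simp
    have e' : g 0 0 * (X / Y) + g 0 1 = (g 0 0 * X + g 0 1 * Y) / Y := by field_simp
    rw [e, e']
    by_cases hD : g 1 0 * X + g 1 1 * Y = 0
    · rw [hD, zero_div, if_pos rfl, spherePoint_zero_right]
    · rw [if_neg (div_ne_zero hD hY), spherePoint_of_ne hD, div_div_div_cancel_right₀ hY]

open Matrix in
theorem linear_ne_zero_of_ne_zero (g : GL (Fin 2) ℂ) {X Y : ℂ} (h : X ≠ 0 ∨ Y ≠ 0) :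
    g 0 0 * X + g 0 1 * Y ≠ 0 ∨ g 1 0 * X + g 1 1 * Y ≠ 0 := by
  by_contra! hcon
  have hdet : g 0 0 * g 1 1 - g 0 1 * g 1 0 ≠ 0 := by
    have := g.det_ne_zero
    rwa [Matrix.det_fin_two] at this
  have hX : (g 0 0 * g 1 1 - g 0 1 * g 1 0) * X = 0 := by
    linear_combination g 1 1 * hcon.1 - g 0 1 * hcon.2
  have hY : (g 0 0 * g 1 1 - g 0 1 * g 1 0) * Y = 0 := by
    linear_combination g 0 0 * hcon.2 - g 1 0 * hcon.1
  rcases h with h | h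
  · exact h ((mul_eq_zero.mp hX).resolve_left hdet)
  · exact h ((mul_eq_zero.mp hY).resolve_left hdet)

open Matrix in
-- In homogeneous coordinates a Möbius map is linear, so differentiability is preserved without
-- regard to where the poles move.
theorem IsHolomorphicToSphere.smul {f : ℂ → OnePoint ℂ} {U : Set ℂ}
    (hf : IsHolomorphicToSphere f U) (hU : IsOpen U) (g : GL (Fin 2) ℂ) :
    IsHolomorphicToSphere (fun z => g • f z) U := by
  have key : ∀ z ∈ U, ContinuousAt (fun z => g • f z) z ∧
      (g • f z ≠ OnePoint.infty → DifferentiableAt ℂ (fun w => sphereCoord (g • f w)) z) ∧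
      (g • f z ≠ ((0 : ℂ) : OnePoint ℂ) →
        DifferentiableAt ℂ (fun w => (sphereCoord (g • f w))⁻¹) z) := by
    intro z hz
    obtain ⟨X, Y, hX, hY, hXY, he⟩ := hf.exists_homogeneous hU hz
    refine holomorphicAt_of_homogeneous (f := fun z => g • f z)
      (X := fun w => g 0 0 * X w + g 0 1 * Y w) (Y := fun w => g 1 0 * X w + g 1 1 * Y w) (z := z)
      ((hX.const_mul _).add (hY.const_mul _)) ((hX.const_mul _).add (hY.const_mul _))
      (linear_ne_zero_of_ne_zero g hXY) ?_
    have hXY' : ∀ᶠ w in 𝓝 z, X w ≠ 0 ∨ Y w ≠ 0 := by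
      rcases hXY with h | h
      · exact (hX.continuousAt.eventually_ne h).mono fun _ => Or.inl
      · exact (hY.continuousAt.eventually_ne h).mono fun _ => Or.inr
    filter_upwards [he, hXY'] with w hw hw'
    rw [hw, smul_spherePoint g hw']
  exact ⟨fun z hz => (key z hz).1.continuousWithinAt, fun z hz => (key z hz).2⟩

theorem isHolomorphicToSphere_coe (U : Set ℂ) :
    IsHolomorphicToSphere (fun z : ℂ => (z : OnePoint ℂ)) U := by
  have key := fun z : ℂ => holomorphicAt_of_homogeneous (f := fun z : ℂ => (z : OnePoint ℂ))
    (X := fun w => w) (Y := fun _ => 1) (z := z) differentiableAt_id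
    (differentiableAt_const _) (Or.inr one_ne_zero)
    (Eventually.of_forall fun w => by
      change (w : OnePoint ℂ) = spherePoint w 1
      rw [spherePoint_of_ne one_ne_zero, div_one])
  exact ⟨fun z _ => (key z).1.continuousWithinAt, fun z _ => (key z).2⟩

theorem isOpen_annulus (ρ : ℝ) : IsOpen {z : ℂ | 1 < ‖z‖ ∧ ‖z‖ < ρ} :=
  (isOpen_lt continuous_const continuous_norm).inter (isOpen_lt continuous_norm continuous_const)

open Matrix in
/-- If a Möbius transformation maps the interior of `A` onto `{1 < |z| < e ^ m}`, then `m` is the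
modulus of `A`. -/
theorem complexModulus_eq_of_smul {A : Set (OnePoint ℂ)} {m : ℝ} (hm : 0 < m)
    (g : GL (Fin 2) ℂ) (hA : ∀ w : OnePoint ℂ, w ∈ interior A ↔
      ∃ z : ℂ, (1 < ‖z‖ ∧ ‖z‖ < Real.exp m) ∧ g • w = (z : OnePoint ℂ)) :
    complexModulus A = m := by
  -- Composing any other uniformization with `g` gives a holomorphic bijection of concentric annuli,
  -- so rigidity makes the set a singleton.
  have hset : {m' : ℝ | HasComplexModulus A m'} = {m} := by
    ext m'
    change HasComplexModulus A m' ↔ m' = m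
    constructor
    · rintro ⟨hm', f, hf, hbij⟩
      set U : Set ℂ := {z : ℂ | 1 < ‖z‖ ∧ ‖z‖ < Real.exp m'} with hU
      have hgf := hf.smul (isOpen_annulus _) g
      have hfin : ∀ z ∈ U, ∃ u : ℂ, (1 < ‖u‖ ∧ ‖u‖ < Real.exp m) ∧ g • f z = (u : OnePoint ℂ) :=
        fun z hz => (hA _).mp (hbij.mapsTo hz)
      have hcoord : ∀ z ∈ U, ((sphereCoord (g • f z) : ℂ) : OnePoint ℂ) = g • f z := by
        intro z hz
        obtain ⟨u, -, e⟩ := hfin z hz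
        rw [e, sphereCoord_coe]
      refine eq_of_bijOn_annulus hm' hm (g := fun z => sphereCoord (g • f z)) ?_ ⟨?_, ?_, ?_⟩
      · intro z hz
        refine ((hgf.2 z hz).1 ?_).differentiableWithinAt
        change g • f z ≠ OnePoint.infty
        rw [← hcoord z hz]
        exact OnePoint.coe_ne_infty _
      · intro z hz
        obtain ⟨u, hu, e⟩ := hfin z hz
        change 1 < ‖sphereCoord (g • f z)‖ ∧ ‖sphereCoord (g • f z)‖ < _
        rw [e, sphereCoord_coe]
        exact hu
      · intro z hz z' hz' e
        have e1 : g • f z = g • f z' := by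
          rw [← hcoord z hz, ← hcoord z' hz']
          exact congrArg _ e
        exact hbij.injOn hz hz' (MulAction.injective g e1)
      · intro u hu
        obtain ⟨z, hz, e⟩ := hbij.surjOn ((hA (g⁻¹ • (u : OnePoint ℂ))).mpr
          ⟨u, hu, smul_inv_smul g _⟩)
        refine ⟨z, hz, ?_⟩
        change sphereCoord (g • f z) = u
        rw [e, smul_inv_smul, sphereCoord_coe]
    · rintro rfl
      refine ⟨hm, fun z => g⁻¹ • (z : OnePoint ℂ),
        (isHolomorphicToSphere_coe _).smul (isOpen_annulus _) g⁻¹, ?_, ?_, ?_⟩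
      · intro z hz
        exact (hA _).mpr ⟨z, hz, smul_inv_smul g _⟩
      · intro z _ z' _ e
        exact OnePoint.coe_injective (MulAction.injective g⁻¹ e)
      · intro w hw
        obtain ⟨z, hz, e⟩ := (hA w).mp hw
        exact ⟨z, hz, by change g⁻¹ • (z : OnePoint ℂ) = w; rw [← e, inv_smul_smul]⟩
  rw [complexModulus, hset, csSup_singleton]

end Sphere

/-! ### The modulus of the region between two circles -/

section CircularAnnuli

theorem isClosed_coe_closedBall (a : ℂ) (R : ℝ) :
    IsClosed (((↑) : ℂ → OnePoint ℂ) '' Metric.closedBall a R) :=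
  OnePoint.isClosed_image_coe.mpr ⟨Metric.isClosed_closedBall, isCompact_closedBall a R⟩

theorem interior_coe_closedBall (a : ℂ) {R : ℝ} (hR : R ≠ 0) :
    interior (((↑) : ℂ → OnePoint ℂ) '' Metric.closedBall a R) =
      ((↑) : ℂ → OnePoint ℂ) '' Metric.ball a R := by
  apply Subset.antisymm
  · intro w hw
    obtain ⟨z, -, rfl⟩ := interior_subset hw
    refine ⟨z, ?_, rfl⟩
    rw [← interior_closedBall a hR]
    have h1 : z ∈ ((↑) : ℂ → OnePoint ℂ) ⁻¹'
        interior (((↑) : ℂ → OnePoint ℂ) '' Metric.closedBall a R) := hw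
    rw [OnePoint.isOpenMap_coe.preimage_interior_eq_interior_preimage OnePoint.continuous_coe,
      preimage_image_eq _ OnePoint.coe_injective] at h1
    exact h1
  · rw [← interior_closedBall a hR]
    exact OnePoint.isOpenMap_coe.image_interior_subset _

theorem exists_annulus_coe_eq_spherePoint_iff {X Y : ℂ} {ρ : ℝ} :
    (∃ u : ℂ, (1 < ‖u‖ ∧ ‖u‖ < ρ) ∧ spherePoint X Y = (u : OnePoint ℂ)) ↔
      ‖Y‖ < ‖X‖ ∧ ‖X‖ < ρ * ‖Y‖ := by
  by_cases h : Y = 0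
  · rw [h, spherePoint_zero_right]
    constructor
    · rintro ⟨u, -, e⟩
      exact absurd e.symm (OnePoint.coe_ne_infty u)
    · rintro ⟨-, h2⟩
      rw [norm_zero, mul_zero] at h2
      exact absurd h2 (not_lt.mpr (norm_nonneg _))
  · have hY : 0 < ‖Y‖ := norm_pos_iff.mpr h
    rw [spherePoint_of_ne h, ← one_lt_div hY, ← div_lt_iff₀ hY, ← norm_div]
    constructor
    · rintro ⟨u, hu, e⟩
      rwa [OnePoint.coe_injective e]
    · exact fun hu => ⟨_, hu, rfl⟩

/-- The parameter of the Möbius transformation that makes two circles concentric. -/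
theorem exists_mobius_parameter {d R r : ℝ} (hd : 0 ≤ d) (hR : 0 < R)
    (hsep : 4 * R ^ 2 * r ^ 2 < (R ^ 2 + r ^ 2 - d ^ 2) ^ 2) (hs : 0 < R ^ 2 + d ^ 2 - r ^ 2) :
    ∃ Λ σ C : ℝ, 0 < Λ ∧ Λ ^ 2 = (R ^ 2 + r ^ 2 - d ^ 2) ^ 2 - 4 * R ^ 2 * r ^ 2 ∧
      0 ≤ σ ∧ σ < 1 ∧ 0 < C ∧ ∀ e p t : ℝ,
      (R ^ 2 + r ^ 2 - d ^ 2 + Λ) * (p - 2 * σ * R * t + σ ^ 2 * R ^ 2 * e) -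
        (R ^ 2 + r ^ 2 - d ^ 2 - Λ) * (R ^ 2 * e - 2 * σ * R * t + σ ^ 2 * p) =
        C * (p - 2 * d * t + (d ^ 2 - r ^ 2) * e) := by
  set W := R ^ 2 + r ^ 2 - d ^ 2 with hW
  set s := R ^ 2 + d ^ 2 - r ^ 2 with hsdef
  set Λ := √(W ^ 2 - 4 * R ^ 2 * r ^ 2) with hΛ
  -- The points at `σ R` and `R / σ` on the line of centres are inverse to each other in both
  -- circles, which amounts to `d R (σ² + 1) = s σ`. The root below `1` is written as `2 d R / (s +
  -- Λ)` so that `d = 0` gives `σ = 0`. In the final identity `p = |P|²`, `t` is the component of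
  -- `P` towards the second centre, and `e` homogenizes: `e = 1` at finite points, `e = 0` at `∞`.
  have hΛpos : 0 < Λ := Real.sqrt_pos.mpr (by linarith)
  have hΛ2 : Λ ^ 2 = W ^ 2 - 4 * R ^ 2 * r ^ 2 := Real.sq_sqrt (by linarith)
  have hE : 0 < s + Λ := by linarith
  have hEs : (s + Λ) * (s - Λ) = 4 * d ^ 2 * R ^ 2 := by
    have : (s + Λ) * (s - Λ) = s ^ 2 - Λ ^ 2 := by ring
    rw [this, hΛ2, hsdef, hW]; ring
  set σ := 2 * d * R / (s + Λ) with hσ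
  have h1 : σ * (s + Λ) = 2 * d * R := by rw [hσ]; field_simp
  have h2 : σ ^ 2 * (s + Λ) = s - Λ := by
    apply mul_right_cancel₀ hE.ne'
    linear_combination (σ * (s + Λ) + 2 * d * R) * h1 - hEs
  refine ⟨Λ, σ, 4 * Λ * R ^ 2 / (s + Λ), hΛpos, hΛ2, by positivity, ?_, by positivity, ?_⟩
  · rw [hσ, div_lt_one hE]
    nlinarith [mul_nonneg hd hR.le]
  · intro e p t
    have hC : 4 * Λ * R ^ 2 / (s + Λ) * (s + Λ) = 4 * Λ * R ^ 2 := by field_simp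
    apply mul_right_cancel₀ hE.ne'
    have e1 : W + s = 2 * R ^ 2 := by rw [hW, hsdef]; ring
    have e2 : s - W = 2 * (d ^ 2 - r ^ 2) := by rw [hW, hsdef]; ring
    linear_combination (-(p - 2 * d * t + (d ^ 2 - r ^ 2) * e)) * hC
      + (-4 * R * t * Λ) * h1 + ((W + Λ) * R ^ 2 * e - (W - Λ) * p) * h2
      + 2 * Λ * p * e1 + 2 * Λ * R ^ 2 * e * e2

theorem exp_arcosh_div {V c Λ : ℝ} (hc : 0 < c) (hcV : c < V) (hΛ : 0 < Λ)
    (h : Λ ^ 2 = V ^ 2 - c ^ 2) : Real.exp (Real.arcosh (V / c)) = (V + Λ) / c := by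
  have h1 : 1 < V / c := (one_lt_div hc).mpr hcV
  rw [Real.exp_arcosh h1.le]
  have : (V / c) ^ 2 - 1 = (Λ / c) ^ 2 := by
    rw [div_pow, div_pow, h]; field_simp
  rw [this, Real.sqrt_sq (by positivity)]
  ring

/-- Since `(V - Λ) * (V + Λ) = c ^ 2`, the square of `(V + Λ) / c` is `(V + Λ) / (V - Λ)`. -/
theorem lt_mul_iff_of_sq {V c Λ x y : ℝ} (hc : 0 < c) (hcV : c < V) (hΛ : 0 < Λ)
    (h : Λ ^ 2 = V ^ 2 - c ^ 2) (hx : 0 ≤ x) (hy : 0 ≤ y) :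
    x < (V + Λ) / c * y ↔ (V - Λ) * x ^ 2 < (V + Λ) * y ^ 2 := by
  have hV : 0 < V := hc.trans hcV
  have hp : 0 < V + Λ := by linarith
  have hm : 0 < V - Λ := by nlinarith
  rw [← pow_lt_pow_iff_left₀ hx (by positivity) two_ne_zero, mul_pow, div_pow,
    ← mul_lt_mul_iff_right₀ hm]
  have : (V - Λ) * ((V + Λ) ^ 2 / c ^ 2 * y ^ 2) = (V + Λ) * y ^ 2 := by
    have : (V - Λ) * (V + Λ) = c ^ 2 := by linear_combination -h
    field_simp
    linear_combination y ^ 2 * this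
  rw [this]

theorem norm_sub_ofReal_mul_sq (P θ : ℂ) (hθ : ‖θ‖ = 1) (s : ℝ) :
    ‖P - s * θ‖ ^ 2 = ‖P‖ ^ 2 - 2 * s * (P.re * θ.re + P.im * θ.im) + s ^ 2 := by
  have h1 : θ.re * θ.re + θ.im * θ.im = 1 := by
    rw [← Complex.normSq_apply, ← Complex.sq_norm, hθ, one_pow]
  rw [Complex.sq_norm, Complex.sq_norm, Complex.normSq_apply, Complex.normSq_apply]
  simp only [Complex.sub_re, Complex.sub_im, Complex.mul_re, Complex.mul_im, Complex.ofReal_re,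
    Complex.ofReal_im]
  linear_combination s ^ 2 * h1

theorem norm_mul_sub_ofReal_mul_sq (P θ : ℂ) (hθ : ‖θ‖ = 1) (R s : ℝ) :
    ‖R * θ - s * P‖ ^ 2 = R ^ 2 - 2 * s * R * (P.re * θ.re + P.im * θ.im) + s ^ 2 * ‖P‖ ^ 2 := by
  have h1 : θ.re * θ.re + θ.im * θ.im = 1 := by
    rw [← Complex.normSq_apply, ← Complex.sq_norm, hθ, one_pow]
  rw [Complex.sq_norm, Complex.sq_norm, Complex.normSq_apply, Complex.normSq_apply]
  simp only [Complex.sub_re, Complex.sub_im, Complex.mul_re, Complex.mul_im, Complex.ofReal_re,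
    Complex.ofReal_im]
  linear_combination R ^ 2 * h1

open Matrix in
theorem smul_coe_eq_spherePoint (g : GL (Fin 2) ℂ) (z : ℂ) :
    g • (z : OnePoint ℂ) = spherePoint (g 0 0 * z + g 0 1) (g 1 0 * z + g 1 1) := by
  have := smul_spherePoint g (X := z) (Y := 1) (Or.inr one_ne_zero)
  rwa [spherePoint_of_ne one_ne_zero, div_one, mul_one, mul_one] at this

open Matrix in
theorem smul_infty_eq_spherePoint (g : GL (Fin 2) ℂ) :
    g • (OnePoint.infty : OnePoint ℂ) = spherePoint (g 0 0) (g 1 0) := by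
  have := smul_spherePoint g (X := 1) (Y := 0) (Or.inl one_ne_zero)
  rwa [spherePoint_zero_right, mul_one, mul_one, mul_zero, mul_zero, add_zero, add_zero] at this

theorem complexModulus_nested {a b : ℂ} {R r : ℝ} (hr : 0 < r) (h : ‖a - b‖ + r < R) :
    complexModulus (((↑) : ℂ → OnePoint ℂ) '' Metric.closedBall a R \
      ((↑) : ℂ → OnePoint ℂ) '' Metric.closedBall b r) =
      Real.arcosh ((R ^ 2 + r ^ 2 - ‖a - b‖ ^ 2) / (2 * R * r)) := by
  set d := ‖a - b‖ with hd
  have hd0 : 0 ≤ d := norm_nonneg _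
  have hR : 0 < R := by linarith
  have hc : 0 < 2 * R * r := by positivity
  have hcV : 2 * R * r < R ^ 2 + r ^ 2 - d ^ 2 := by nlinarith
  obtain ⟨Λ, σ, C, hΛ, hΛ2, hσ0, hσ1, hC, hid⟩ := exists_mobius_parameter (r := r) hd0 hR
    (by nlinarith) (by nlinarith)
  set V := R ^ 2 + r ^ 2 - d ^ 2 with hV
  have hΛ2' : Λ ^ 2 = V ^ 2 - (2 * R * r) ^ 2 := by rw [hΛ2]; ring
  obtain ⟨θ, hθ, hb⟩ := exists_unit_direction (b - a)
  rw [norm_sub_rev, ← hd] at hb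
  have hθ0 : θ ≠ 0 := norm_pos_iff.mp (by rw [hθ]; exact one_pos)
  -- With `P = z - a`, the map is `(R θ - σ P) / (P - σ R θ)`. It sends the circle `|P| = R` to the
  -- unit circle, and its inside to the outside of the unit disk.
  have hdet : (!![-(σ : ℂ), R * θ + σ * a; 1, -a - σ * R * θ] : Matrix (Fin 2) (Fin 2) ℂ).det ≠ 0 := by
    rw [Matrix.det_fin_two_of]
    have e : -(σ : ℂ) * (-a - σ * R * θ) - (R * θ + σ * a) * 1 =
        (((σ ^ 2 - 1) * R : ℝ) : ℂ) * θ := by push_cast; ring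
    rw [e]
    refine mul_ne_zero (Complex.ofReal_ne_zero.mpr (mul_ne_zero ?_ hR.ne')) hθ0
    nlinarith
  refine complexModulus_eq_of_smul (Real.arcosh_pos ((one_lt_div hc).mpr hcV))
    (Matrix.GeneralLinearGroup.mkOfDetNeZero _ hdet) ?_
  rw [exp_arcosh_div hc hcV hΛ hΛ2']
  intro w
  rw [sdiff_eq, interior_inter, (isClosed_coe_closedBall b r).isOpen_compl.interior_eq,
    interior_coe_closedBall a hR.ne']
  induction w using OnePoint.rec with
  | infty =>
    rw [smul_infty_eq_spherePoint, exists_annulus_coe_eq_spherePoint_iff]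
    refine ⟨fun hw => absurd hw.1 OnePoint.infty_notMem_image_coe, fun hw => ?_⟩
    have h1 : ‖(1 : ℂ)‖ < ‖-(σ : ℂ)‖ := hw.1
    rw [norm_one, norm_neg, Complex.norm_real, Real.norm_eq_abs, abs_of_nonneg hσ0] at h1
    linarith
  | coe z =>
    rw [smul_coe_eq_spherePoint, exists_annulus_coe_eq_spherePoint_iff]
    change _ ↔ ‖1 * z + (-a - σ * R * θ)‖ < ‖-(σ : ℂ) * z + (R * θ + σ * a)‖ ∧
      ‖-(σ : ℂ) * z + (R * θ + σ * a)‖ < _ * ‖1 * z + (-a - σ * R * θ)‖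
    set P := z - a with hP
    have eN : 1 * z + (-a - σ * R * θ) = P - ((σ * R : ℝ) : ℂ) * θ := by rw [hP]; push_cast; ring
    have eD : -(σ : ℂ) * z + (R * θ + σ * a) = R * θ - σ * P := by rw [hP]; ring
    have eb : z - b = P - (d : ℂ) * θ := by rw [hP]; linear_combination -hb
    rw [eN, eD, lt_mul_iff_of_sq hc hcV hΛ hΛ2' (norm_nonneg _) (norm_nonneg _),
      ← pow_lt_pow_iff_left₀ (norm_nonneg _) (norm_nonneg _) two_ne_zero,
      norm_sub_ofReal_mul_sq P θ hθ, norm_mul_sub_ofReal_mul_sq P θ hθ, mem_inter_iff,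
      mem_compl_iff, OnePoint.coe_injective.mem_set_image, OnePoint.coe_injective.mem_set_image,
      mem_ball_iff_norm, mem_closedBall_iff_norm, not_le, eb,
      ← pow_lt_pow_iff_left₀ (norm_nonneg _) hR.le two_ne_zero,
      ← pow_lt_pow_iff_left₀ hr.le (norm_nonneg _) two_ne_zero, norm_sub_ofReal_mul_sq P θ hθ]
    have key := hid 1 (‖P‖ ^ 2) (P.re * θ.re + P.im * θ.im)
    have hσ2 : 0 < 1 - σ ^ 2 := by nlinarith
    -- The unit-circle condition is `(1 - σ²)(R² - |P|²) > 0`. The outer one is, by `key`, `C (|z -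
    -- b|² - r²) > 0`.
    refine and_congr ?_ ?_
    · rw [← sub_pos, ← mul_pos_iff_of_pos_left hσ2, ← sub_pos (b := _ + (σ * R) ^ 2)]
      refine iff_of_eq (congrArg (0 < ·) ?_)
      ring
    · rw [← sub_pos, ← mul_pos_iff_of_pos_left hC, ← sub_pos (b := (V - Λ) * _)]
      refine iff_of_eq (congrArg (0 < ·) ?_)
      linear_combination -key

theorem complexModulus_disjoint {a b : ℂ} {R r : ℝ} (hR : 0 < R) (hr : 0 < r)
    (h : R + r < ‖a - b‖) :
    complexModulus ((((↑) : ℂ → OnePoint ℂ) '' Metric.closedBall a R)ᶜ \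
      ((↑) : ℂ → OnePoint ℂ) '' Metric.closedBall b r) =
      Real.arcosh ((‖a - b‖ ^ 2 - R ^ 2 - r ^ 2) / (2 * R * r)) := by
  set d := ‖a - b‖ with hd
  have hd0 : 0 ≤ d := norm_nonneg _
  have hc : 0 < 2 * R * r := by positivity
  have hcV : 2 * R * r < d ^ 2 - R ^ 2 - r ^ 2 := by nlinarith
  obtain ⟨Λ, σ, C, hΛ, hΛ2, hσ0, hσ1, hC, hid⟩ := exists_mobius_parameter (r := r) hd0 hR
    (by nlinarith) (by nlinarith)
  set V := d ^ 2 - R ^ 2 - r ^ 2 with hV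
  have hΛ2' : Λ ^ 2 = V ^ 2 - (2 * R * r) ^ 2 := by rw [hΛ2, hV]; ring
  obtain ⟨θ, hθ, hb⟩ := exists_unit_direction (b - a)
  rw [norm_sub_rev, ← hd] at hb
  have hθ0 : θ ≠ 0 := norm_pos_iff.mp (by rw [hθ]; exact one_pos)
  -- This is the inverse of the quotient used for nested disks: here the outside of `|P| = R` must
  -- go outside the unit disk. Accordingly `V` changes sign.
  have hdet : (!![1, -a - σ * R * θ; -(σ : ℂ), R * θ + σ * a] : Matrix (Fin 2) (Fin 2) ℂ).det ≠ 0 := by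
    rw [Matrix.det_fin_two_of]
    have e : 1 * (R * θ + σ * a) - (-a - σ * R * θ) * -(σ : ℂ) =
        (((1 - σ ^ 2) * R : ℝ) : ℂ) * θ := by push_cast; ring
    rw [e]
    refine mul_ne_zero (Complex.ofReal_ne_zero.mpr (mul_ne_zero ?_ hR.ne')) hθ0
    nlinarith
  refine complexModulus_eq_of_smul (Real.arcosh_pos ((one_lt_div hc).mpr hcV))
    (Matrix.GeneralLinearGroup.mkOfDetNeZero _ hdet) ?_
  rw [exp_arcosh_div hc hcV hΛ hΛ2']
  intro w
  rw [sdiff_eq, interior_inter, (isClosed_coe_closedBall b r).isOpen_compl.interior_eq,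
    (isClosed_coe_closedBall a R).isOpen_compl.interior_eq]
  induction w using OnePoint.rec with
  | infty =>
    rw [smul_infty_eq_spherePoint, exists_annulus_coe_eq_spherePoint_iff]
    refine iff_of_true ⟨OnePoint.infty_notMem_image_coe, OnePoint.infty_notMem_image_coe⟩ ?_
    change ‖-(σ : ℂ)‖ < ‖(1 : ℂ)‖ ∧ ‖(1 : ℂ)‖ < _ * ‖-(σ : ℂ)‖
    rw [lt_mul_iff_of_sq hc hcV hΛ hΛ2' (norm_nonneg _) (norm_nonneg _), norm_one, norm_neg,
      Complex.norm_real, Real.norm_eq_abs, abs_of_nonneg hσ0]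
    refine ⟨hσ1, ?_⟩
    -- The identity at `e = 0`, `p = 1`, `t = 0` is the outer condition at the point `∞`.
    have key := hid 0 1 0
    rw [hV]
    linarith
  | coe z =>
    rw [smul_coe_eq_spherePoint, exists_annulus_coe_eq_spherePoint_iff]
    change _ ↔ ‖-(σ : ℂ) * z + (R * θ + σ * a)‖ < ‖1 * z + (-a - σ * R * θ)‖ ∧
      ‖1 * z + (-a - σ * R * θ)‖ < _ * ‖-(σ : ℂ) * z + (R * θ + σ * a)‖
    set P := z - a with hP
    have eN : 1 * z + (-a - σ * R * θ) = P - ((σ * R : ℝ) : ℂ) * θ := by rw [hP]; push_cast; ring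
    have eD : -(σ : ℂ) * z + (R * θ + σ * a) = R * θ - σ * P := by rw [hP]; ring
    have eb : z - b = P - (d : ℂ) * θ := by rw [hP]; linear_combination -hb
    rw [eN, eD, lt_mul_iff_of_sq hc hcV hΛ hΛ2' (norm_nonneg _) (norm_nonneg _),
      ← pow_lt_pow_iff_left₀ (norm_nonneg _) (norm_nonneg _) two_ne_zero,
      norm_sub_ofReal_mul_sq P θ hθ, norm_mul_sub_ofReal_mul_sq P θ hθ, mem_inter_iff,
      mem_compl_iff, mem_compl_iff, OnePoint.coe_injective.mem_set_image,
      OnePoint.coe_injective.mem_set_image,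
      mem_closedBall_iff_norm, mem_closedBall_iff_norm, not_le, not_le, eb,
      ← pow_lt_pow_iff_left₀ hR.le (norm_nonneg _) two_ne_zero,
      ← pow_lt_pow_iff_left₀ hr.le (norm_nonneg _) two_ne_zero, norm_sub_ofReal_mul_sq P θ hθ]
    have key := hid 1 (‖P‖ ^ 2) (P.re * θ.re + P.im * θ.im)
    have hσ2 : 0 < 1 - σ ^ 2 := by nlinarith
    refine and_congr ?_ ?_
    · rw [← sub_pos, ← mul_pos_iff_of_pos_left hσ2,
        ← sub_pos (b := R ^ 2 - _ + _)]
      refine iff_of_eq (congrArg (0 < ·) ?_)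
      ring
    · rw [← sub_pos, ← mul_pos_iff_of_pos_left hC, ← sub_pos (b := (V - Λ) * _)]
      refine iff_of_eq (congrArg (0 < ·) ?_)
      rw [hV]
      linear_combination -key

end CircularAnnuli

/-! ### The limit of the Archimedean modulus as the exponent tends to 0 -/

section Limits

/-- The modulus of an annulus over a field with absolute value `|·|_∞ ^ ε`, in terms of the
distance `d` of the centres and the radii `R`, `r`. -/
noncomputable def archModulus (ε d R r : ℝ) : ℝ :=
  ε * Real.arcosh (|(R ^ ε⁻¹) ^ 2 + (r ^ ε⁻¹) ^ 2 - (d ^ ε⁻¹) ^ 2| / (2 * R ^ ε⁻¹ * r ^ ε⁻¹))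

/-- Two disks of radii `R`, `r` at distance `d` are strictly nested or disjoint, in the
non-Archimedean sense. -/
def StrictlySeparated (d R r : ℝ) : Prop :=
  (r < R ∧ d < R) ∨ (R < r ∧ d < r) ∨ (R < d ∧ r < d)

theorem log_le_arcosh {x : ℝ} (hx : 0 < x) : Real.log x ≤ Real.arcosh x :=
  Real.log_le_log hx (le_add_of_nonneg_right (Real.sqrt_nonneg _))

theorem arcosh_le_log_add {x : ℝ} (hx : 0 < x) : Real.arcosh x ≤ Real.log x + Real.log 2 := by
  rw [← Real.log_mul hx.ne' two_ne_zero]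
  refine Real.log_le_log (add_pos_of_pos_of_nonneg hx (Real.sqrt_nonneg _)) ?_
  have : √(x ^ 2 - 1) ≤ x := Real.sqrt_le_iff.mpr ⟨hx.le, by linarith⟩
  linarith

variable {ι : Type*} {l : Filter ι} {e : ι → ℝ}

theorem tendsto_rpow_inv_zero (he : Tendsto e l (𝓝[>] 0)) {p : ι → ℝ} {p₀ : ℝ}
    (hp : Tendsto p l (𝓝 p₀)) (h0 : ∀ᶠ i in l, 0 ≤ p i) (h1 : p₀ < 1) :
    Tendsto (fun i => p i ^ (e i)⁻¹) l (𝓝 0) := by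
  obtain ⟨q, hq, hq1⟩ := exists_between (max_lt h1 zero_lt_one)
  have hq0 : 0 < q := (le_max_right _ _).trans_lt hq
  have hpq : p₀ < q := (le_max_left _ _).trans_lt hq
  have hinv : Tendsto (fun i => (e i)⁻¹) l atTop := tendsto_inv_nhdsGT_zero.comp he
  have hlim : Tendsto (fun i => q ^ (e i)⁻¹) l (𝓝 0) :=
    (tendsto_rpow_atTop_of_base_lt_one q (by linarith) hq1).comp hinv
  refine squeeze_zero' ?_ ?_ hlim
  · filter_upwards [h0] with i hi
    exact Real.rpow_nonneg hi _
  · filter_upwards [h0, hp.eventually (gt_mem_nhds hpq), he.eventually self_mem_nhdsWithin]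
      with i hi hi' hei
    exact Real.rpow_le_rpow hi hi'.le (inv_nonneg.mpr (le_of_lt hei))

/-- Replacing `arcosh` by `log` costs at most `e i * log 2`, and `e i * log (M ^ (1/e))` is just
`log M`. The correction `κ → 1` contributes nothing in the limit. -/
theorem tendsto_mul_arcosh (he : Tendsto e l (𝓝[>] 0)) {M R r κ : ι → ℝ} {M₀ R₀ r₀ : ℝ}
    (hM : Tendsto M l (𝓝 M₀)) (hR : Tendsto R l (𝓝 R₀)) (hr : Tendsto r l (𝓝 r₀))
    (hκ : Tendsto κ l (𝓝 1)) (hM₀ : 0 < M₀) (hR₀ : 0 < R₀) (hr₀ : 0 < r₀) :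
    Tendsto (fun i => e i * Real.arcosh
      ((M i ^ (e i)⁻¹) ^ 2 * κ i / (2 * R i ^ (e i)⁻¹ * r i ^ (e i)⁻¹))) l
      (𝓝 (2 * Real.log M₀ - Real.log R₀ - Real.log r₀)) := by
  have he0 : Tendsto e l (𝓝 0) := he.mono_right nhdsWithin_le_nhds
  have hepos : ∀ᶠ i in l, 0 < e i := he.eventually self_mem_nhdsWithin
  have hMp := hM.eventually (lt_mem_nhds hM₀)
  have hRp := hR.eventually (lt_mem_nhds hR₀)
  have hrp := hr.eventually (lt_mem_nhds hr₀)
  have hκp := hκ.eventually (lt_mem_nhds zero_lt_one)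
  have hmain : Tendsto (fun i => 2 * Real.log (M i) + e i * Real.log (κ i) - e i * Real.log 2 -
      Real.log (R i) - Real.log (r i)) l
      (𝓝 (2 * Real.log M₀ - Real.log R₀ - Real.log r₀)) := by
    have := (((((hM.log hM₀.ne').const_mul 2).add (he0.mul (hκ.log one_ne_zero))).sub
      (he0.mul_const (Real.log 2))).sub (hR.log hR₀.ne')).sub (hr.log hr₀.ne')
    simpa using this
  have hupper : Tendsto (fun i => 2 * Real.log (M i) + e i * Real.log (κ i) - e i * Real.log 2 -
      Real.log (R i) - Real.log (r i) + e i * Real.log 2) l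
      (𝓝 (2 * Real.log M₀ - Real.log R₀ - Real.log r₀)) := by
    simpa using hmain.add (he0.mul_const (Real.log 2))
  have hlog : ∀ᶠ i in l, 0 < (M i ^ (e i)⁻¹) ^ 2 * κ i / (2 * R i ^ (e i)⁻¹ * r i ^ (e i)⁻¹) ∧
      e i * Real.log ((M i ^ (e i)⁻¹) ^ 2 * κ i / (2 * R i ^ (e i)⁻¹ * r i ^ (e i)⁻¹)) =
      2 * Real.log (M i) + e i * Real.log (κ i) - e i * Real.log 2 -
      Real.log (R i) - Real.log (r i) := by
    filter_upwards [hepos, hMp, hRp, hrp, hκp] with i h1 h2 h3 h4 h5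
    have a1 := Real.rpow_pos_of_pos h2 (e i)⁻¹
    have a2 := Real.rpow_pos_of_pos h3 (e i)⁻¹
    have a3 := Real.rpow_pos_of_pos h4 (e i)⁻¹
    refine ⟨by positivity, ?_⟩
    rw [Real.log_div (by positivity) (by positivity), Real.log_mul (by positivity) h5.ne',
      Real.log_mul (by positivity) a3.ne', Real.log_mul two_ne_zero a2.ne', Real.log_pow,
      Real.log_rpow h2, Real.log_rpow h3, Real.log_rpow h4]
    field_simp
    push_cast
    ring
  refine tendsto_of_tendsto_of_tendsto_of_le_of_le' hmain hupper ?_ ?_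
  · filter_upwards [hlog, hepos] with i hi hei
    rw [← hi.2]
    exact mul_le_mul_of_nonneg_left (log_le_arcosh hi.1) hei.le
  · filter_upwards [hlog, hepos] with i hi hei
    rw [← hi.2, ← mul_add]
    exact mul_le_mul_of_nonneg_left (arcosh_le_log_add hi.1) hei.le

theorem tendsto_one_sub_add_rpow (he : Tendsto e l (𝓝[>] 0)) {p q : ι → ℝ} {p₀ q₀ : ℝ}
    (hp : Tendsto p l (𝓝 p₀)) (hp0 : ∀ᶠ i in l, 0 ≤ p i) (hp1 : p₀ < 1)
    (hq : Tendsto q l (𝓝 q₀)) (hq0 : ∀ᶠ i in l, 0 ≤ q i) (hq1 : q₀ < 1) (s : ℝ) :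
    Tendsto (fun i => |1 + s * (p i ^ (e i)⁻¹) ^ 2 - (q i ^ (e i)⁻¹) ^ 2|) l (𝓝 1) := by
  have h1 := tendsto_rpow_inv_zero he hp hp0 hp1
  have h2 := tendsto_rpow_inv_zero he hq hq0 hq1
  simpa using ((((h1.pow 2).const_mul s).const_add 1).sub (h2.pow 2)).abs

/-- As `ε → 0`, the modulus tends to the distance in the Berkovich tree. -/
theorem tendsto_archModulus (he : Tendsto e l (𝓝[>] 0)) {d R r : ι → ℝ} {d₀ R₀ r₀ : ℝ}
    (hd : Tendsto d l (𝓝 d₀)) (hR : Tendsto R l (𝓝 R₀)) (hr : Tendsto r l (𝓝 r₀))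
    (hdn : ∀ i, 0 ≤ d i) (hR₀ : 0 < R₀) (hr₀ : 0 < r₀) (hsep : StrictlySeparated d₀ R₀ r₀) :
    Tendsto (fun i => archModulus (e i) (d i) (R i) (r i)) l
      (𝓝 (2 * Real.log (max d₀ (max R₀ r₀)) - Real.log R₀ - Real.log r₀)) := by
  have hRp := hR.eventually (lt_mem_nhds hR₀)
  have hrp := hr.eventually (lt_mem_nhds hr₀)
  rcases hsep with ⟨h1, h2⟩ | ⟨h1, h2⟩ | ⟨h1, h2⟩
  · rw [max_eq_left h1.le, max_eq_right h2.le]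
    -- In each case the power of the largest number is factored out. What remains is `κ`, where the
    -- ratios of the other two to it have limits below `1`, so their powers `1/ε` vanish.
    have hκ := tendsto_one_sub_add_rpow he (hr.div hR hR₀.ne')
      (by filter_upwards [hRp, hrp] with i a b; exact (div_pos b a).le) ((div_lt_one hR₀).mpr h1)
      (hd.div hR hR₀.ne') (by filter_upwards [hRp] with i a; exact div_nonneg (hdn i) a.le)
      ((div_lt_one hR₀).mpr h2) 1
    refine (tendsto_mul_arcosh he hR hR hr hκ hR₀ hR₀ hr₀).congr' ?_
    filter_upwards [hRp, hrp] with i a b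
    have a1 := Real.rpow_pos_of_pos a (e i)⁻¹
    rw [archModulus, Pi.div_apply, Pi.div_apply, Real.div_rpow b.le a.le,
      Real.div_rpow (hdn i) a.le, ← abs_of_pos (pow_pos a1 2), ← abs_mul, abs_of_pos (pow_pos a1 2)]
    congr 4
    field_simp
  · rw [max_eq_right h1.le, max_eq_right h2.le]
    have hκ := tendsto_one_sub_add_rpow he (hR.div hr hr₀.ne')
      (by filter_upwards [hRp, hrp] with i a b; exact (div_pos a b).le) ((div_lt_one hr₀).mpr h1)
      (hd.div hr hr₀.ne') (by filter_upwards [hrp] with i a; exact div_nonneg (hdn i) a.le)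
      ((div_lt_one hr₀).mpr h2) 1
    refine (tendsto_mul_arcosh he hr hR hr hκ hr₀ hR₀ hr₀).congr' ?_
    filter_upwards [hRp, hrp] with i a b
    have a1 := Real.rpow_pos_of_pos b (e i)⁻¹
    rw [archModulus, Pi.div_apply, Pi.div_apply, Real.div_rpow a.le b.le,
      Real.div_rpow (hdn i) b.le, ← abs_of_pos (pow_pos a1 2), ← abs_mul, abs_of_pos (pow_pos a1 2)]
    congr 4
    field_simp
    ring
  · have hd₀ : 0 < d₀ := hR₀.trans h1
    have hdp := hd.eventually (lt_mem_nhds hd₀)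
    rw [max_eq_left (max_le h1.le h2.le)]
    have hκ := tendsto_one_sub_add_rpow he (hR.div hd hd₀.ne')
      (by filter_upwards [hRp, hdp] with i a b; exact (div_pos a b).le) ((div_lt_one hd₀).mpr h1)
      (hr.div hd hd₀.ne') (by filter_upwards [hrp, hdp] with i a b; exact (div_pos a b).le)
      ((div_lt_one hd₀).mpr h2) (-1)
    refine (tendsto_mul_arcosh he hd hR hr hκ hd₀ hR₀ hr₀).congr' ?_
    filter_upwards [hRp, hrp, hdp] with i a b c
    have a1 := Real.rpow_pos_of_pos c (e i)⁻¹
    rw [archModulus, Pi.div_apply, Pi.div_apply, Real.div_rpow a.le c.le,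
      Real.div_rpow b.le c.le, ← abs_of_pos (pow_pos a1 2), ← abs_mul, abs_of_pos (pow_pos a1 2),
      ← abs_neg]
    congr 4
    field_simp
    ring

/-- The path between the two points climbs to radius `max d R r` and descends again. This single
formula is continuous in `d`, `R`, `r` across the cases of `treeDist`. -/
theorem treeDist_eq_of_strictlySeparated {k : Type*} [NormedField k] {a b : k} {R r : ℝ}
    (hR : 0 < R) (hr : 0 < r) (h : StrictlySeparated ‖a - b‖ R r) :
    treeDist a R b r =
      2 * Real.log (max ‖a - b‖ (max R r)) - Real.log R - Real.log r := by
  unfold treeDist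
  rcases h with ⟨h1, h2⟩ | ⟨h1, h2⟩ | ⟨h1, h2⟩
  · rw [if_pos (h2.le.trans (le_max_left _ _)), max_eq_left h1.le, max_eq_right h2.le,
      abs_of_pos (Real.log_pos ((one_lt_div hr).mpr h1)), Real.log_div hR.ne' hr.ne']
    ring
  · rw [if_pos (h2.le.trans (le_max_right _ _)), max_eq_right h1.le, max_eq_right h2.le,
      abs_of_neg (Real.log_neg (by positivity) ((div_lt_one hr).mpr h1)),
      Real.log_div hR.ne' hr.ne']
    ring
  · have hd : 0 < ‖a - b‖ := hR.trans h1
    rw [if_neg (not_le.mpr (max_lt h1 h2)), max_eq_left (max_le h1.le h2.le),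
      abs_of_pos (Real.log_pos ((one_lt_div hR).mpr h1)),
      abs_of_neg (Real.log_neg (by positivity) ((div_lt_one hd).mpr h2)),
      Real.log_div hd.ne' hR.ne', Real.log_div hr.ne' hd.ne']
    ring

theorem treeDist_nonneg {k : Type*} [NormedField k] (a b : k) (R r : ℝ) :
    0 ≤ treeDist a R b r := by
  unfold treeDist
  split_ifs <;> positivity

end Limits

/-! ### The explicit Archimedean modulus of a cut-out annulus -/

section ArchModulus

variable {k : Type*} [NormedField k] (s : ArchStructure k) {a b : k} {R r : ℝ}
  {A : Set (ProjLineAn k)}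

/-- The quantity `R'² + r'² - d'²` is positive for nested disks and negative for disjoint ones; the
absolute value in `archModulus` unites the cases. -/
theorem ArchStructure.modulus_eq (hR : 0 < R) (hr : 0 < r) (hA : CutOutAnnulus a R b r A) :
    s.ε * complexModulus (s.projPoint ⁻¹' A) = archModulus s.ε ‖a - b‖ R r := by
  have hR' := Real.rpow_pos_of_pos hR s.ε⁻¹
  have hr' := Real.rpow_pos_of_pos hr s.ε⁻¹
  rw [archModulus, ← s.norm_map_sub]
  rcases s.preimage_of_cutOutAnnulus hR hr hA with ⟨h1, h2⟩ | ⟨h1, h2⟩ | ⟨h1, h2⟩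
  · have h0 := norm_nonneg (s.σ a - s.σ b)
    rw [h2, complexModulus_nested hr' h1, abs_of_pos (by nlinarith)]
  · have h0 := norm_nonneg (s.σ a - s.σ b)
    rw [h2, complexModulus_nested hR' (by rwa [norm_sub_rev]), norm_sub_rev,
      abs_of_pos (by nlinarith), add_comm ((R ^ s.ε⁻¹) ^ 2), mul_right_comm]
  · rw [h2, complexModulus_disjoint hR' hr' h1, abs_of_neg (by nlinarith)]
    congr 3
    ring

theorem ArchStructure.one_lt_cosh_modulus (hR : 0 < R) (hr : 0 < r)
    (hA : CutOutAnnulus a R b r A) :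
    1 < |(R ^ s.ε⁻¹) ^ 2 + (r ^ s.ε⁻¹) ^ 2 - (‖a - b‖ ^ s.ε⁻¹) ^ 2| /
      (2 * R ^ s.ε⁻¹ * r ^ s.ε⁻¹) := by
  have hR' := Real.rpow_pos_of_pos hR s.ε⁻¹
  have hr' := Real.rpow_pos_of_pos hr s.ε⁻¹
  rw [one_lt_div (by positivity), ← s.norm_map_sub, lt_abs]
  have h0 := norm_nonneg (s.σ a - s.σ b)
  rcases s.preimage_of_cutOutAnnulus hR hr hA with ⟨h1, -⟩ | ⟨h1, -⟩ | ⟨h1, -⟩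
  · exact Or.inl (by nlinarith)
  · exact Or.inl (by nlinarith)
  · exact Or.inr (by nlinarith)

end ArchModulus

/-! ### Continuity of norms of analytic functions -/

namespace AffineAn

variable {𝒜 : Type*} [NormedCommRing 𝒜] {n : ℕ}

theorem continuous_toSeminorm (P : MvPolynomial (Fin n) 𝒜) :
    Continuous fun x : AffineAn 𝒜 n => x.toSeminorm P :=
  (continuous_apply P).comp continuous_induced_dom

theorem norm_eval (x : AffineAn 𝒜 n) (P : MvPolynomial (Fin n) 𝒜) :
    ‖x.eval P‖ = x.toSeminorm P := by
  refine (UniformSpace.Completion.norm_coe _).trans ?_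
  have := fractionAbs_div (quotientAbs x.toSeminorm)
    (Ideal.Quotient.mk (seminormKer x.toSeminorm) P) one_ne_zero
  rw [map_one, div_one, map_one, div_one] at this
  exact this.trans (quotientAbs_mk _ _)

theorem eval_ne_zero {x : AffineAn 𝒜 n} {Q : MvPolynomial (Fin n) 𝒜} (h : x.toSeminorm Q ≠ 0) :
    x.eval Q ≠ 0 := by
  rw [← norm_ne_zero_iff, norm_eval]
  exact h

/-- The values lie in varying fields, so only norms can be compared. Near a point `α - β` is
uniformly close to a fraction of polynomials, whose norm is a ratio of seminorms and thus
continuous; a uniform limit of continuous functions is continuous. -/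
theorem continuous_norm_sub {V : Set (AffineAn 𝒜 n)} {α β : ∀ x : V, x.1.ResidueField}
    (hα : IsAnalytic V α) (hβ : IsAnalytic V β) : Continuous fun x : V => ‖α x - β x‖ := by
  rw [continuous_iff_continuousAt]
  intro x₀
  obtain ⟨W, hW, hxW, -, hWα⟩ := hα x₀
  obtain ⟨W', hW', hxW', -, hWβ⟩ := hβ x₀
  rw [Metric.continuousAt_iff']
  intro η hη
  obtain ⟨P, Q, hQ, hPQ⟩ := hWα (η / 6) (by positivity)
  obtain ⟨P', Q', hQ', hPQ'⟩ := hWβ (η / 6) (by positivity)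
  set G : V → ℝ := fun y => y.1.toSeminorm (P * Q' - Q * P') / y.1.toSeminorm (Q * Q') with hG
  have hGeq : ∀ y : V, y.1 ∈ W → y.1 ∈ W' →
      G y = ‖y.1.eval P / y.1.eval Q - y.1.eval P' / y.1.eval Q'‖ := by
    intro y hy hy'
    rw [div_sub_div _ _ (eval_ne_zero (hQ _ hy)) (eval_ne_zero (hQ' _ hy')), norm_div]
    simp only [hG, ← norm_eval]
    simp only [AffineAn.eval, map_sub, map_mul]
  have hGc : ContinuousAt G x₀ := by
    refine ((continuous_toSeminorm _).comp continuous_subtype_val).continuousAt.div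
      ((continuous_toSeminorm _).comp continuous_subtype_val).continuousAt ?_
    change x₀.1.toSeminorm (Q * Q') ≠ 0
    rw [map_mul]
    exact mul_ne_zero (hQ _ hxW) (hQ' _ hxW')
  have hest : ∀ y : V, y.1 ∈ W → y.1 ∈ W' → |‖α y - β y‖ - G y| ≤ η / 3 := by
    intro y hy hy'
    rw [hGeq y hy hy']
    refine (abs_norm_sub_norm_le _ _).trans ?_
    rw [sub_sub_sub_comm]
    refine (norm_sub_le _ _).trans ?_
    linarith [hPQ y hy, hPQ' y hy']
  have hWn : ∀ᶠ y : V in 𝓝 x₀, y.1 ∈ W ∧ y.1 ∈ W' :=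
    continuous_subtype_val.continuousAt.eventually_mem
      ((hW.inter hW').mem_nhds ⟨hxW, hxW'⟩)
  filter_upwards [hWn, Metric.continuousAt_iff'.mp hGc (η / 3) (by positivity)] with y hy hGy
  rw [Real.dist_eq] at hGy ⊢
  have h1 := abs_le.mp (hest y hy.1 hy.2)
  have h2 := abs_le.mp (hest x₀ hxW hxW')
  have h3 := abs_lt.mp hGy
  rw [abs_lt]
  constructor <;> linarith

theorem continuous_norm_two : Continuous fun x : AffineAn 𝒜 n => ‖(2 : x.ResidueField)‖ := by
  have : (fun x : AffineAn 𝒜 n => ‖(2 : x.ResidueField)‖) = fun x => x.toSeminorm 2 := by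
    ext x
    rw [← norm_eval, AffineAn.eval, map_ofNat]
  rw [this]
  exact continuous_toSeminorm 2

end AffineAn

/-! ### The modulus in terms of continuous data, and the main theorem -/

section Continuity

variable {k : Type*} [NormedField k] {a b : k} {R r : ℝ} {A : Set (ProjLineAn k)}

/-- The right side no longer involves the structure picked in the definition of `annulusModulus`. -/
theorem annulusModulus_of_arch (h : 1 < ‖(2 : k)‖) (hR : 0 < R) (hr : 0 < r)
    (hA : CutOutAnnulus a R b r A) :
    annulusModulus a R b r A = archModulus (Real.logb 2 ‖(2 : k)‖) ‖a - b‖ R r := by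
  have hne := nonempty_archStructure h
  rw [annulusModulus, dif_pos hne, hne.some.modulus_eq hR hr hA, hne.some.ε_eq]

theorem annulusModulus_of_nonarch (h : ¬1 < ‖(2 : k)‖) :
    annulusModulus a R b r A = treeDist a R b r := by
  rw [annulusModulus, dif_neg (mt nonempty_archStructure_iff.mp h)]

theorem annulusModulus_nonneg (hR : 0 < R) (hr : 0 < r) (hA : CutOutAnnulus a R b r A) :
    0 ≤ annulusModulus a R b r A := by
  by_cases h : 1 < ‖(2 : k)‖
  · obtain ⟨s⟩ := nonempty_archStructure h
    rw [annulusModulus_of_arch h hR hr hA, ← s.ε_eq, archModulus]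
    exact mul_nonneg s.ε_pos.le (Real.arcosh_nonneg (s.one_lt_cosh_modulus hR hr hA).le)
  · rw [annulusModulus_of_nonarch h]
    exact treeDist_nonneg _ _ _ _

end Continuity

theorem mainTheorem10 (n : ℕ) (hn : 1 ≤ n) (V : Set (AffineAn ℤ n)) (hV : IsOpen V)
    (α β : ∀ x : V, x.1.ResidueField)
    (hα : AffineAn.IsAnalytic V α) (hβ : AffineAn.IsAnalytic V β)
    (R r : V → ℝ) (hR : Continuous R) (hr : Continuous r)
    (hRpos : ∀ x, 0 < R x) (hrpos : ∀ x, 0 < r x)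
    (A : ∀ x : V, Set (ProjLineAn x.1.ResidueField))
    (hA : ∀ x : V, CutOutAnnulus (α x) (R x) (β x) (r x) (A x)) :
    Continuous (fun x : V => annulusModulus (α x) (R x) (β x) (r x) (A x)) ∧
    (∀ x : V, 0 ≤ annulusModulus (α x) (R x) (β x) (r x) (A x)) ∧
    (∀ x₀ : V, IsNonArch x₀.1.ResidueField → ∀ δ : ℝ, 0 < δ →
      ∀ᶠ x in 𝓝 x₀, ∀ d : ArchStructure x.1.ResidueField,
        |d.ε * complexModulus (d.projPoint ⁻¹' A x) -
          treeDist (α x₀) (R x₀) (β x₀) (r x₀)| < δ) := by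
  have hd : Continuous fun x : V => ‖α x - β x‖ := AffineAn.continuous_norm_sub hα hβ
  have h2 : Continuous fun x : V => ‖(2 : x.1.ResidueField)‖ :=
    AffineAn.continuous_norm_two.comp continuous_subtype_val
  set arch : Set V := {x | 1 < ‖(2 : x.1.ResidueField)‖} with harch
  have hsep : ∀ x : V, ¬1 < ‖(2 : x.1.ResidueField)‖ →
      StrictlySeparated ‖α x - β x‖ (R x) (r x) := fun x hx =>
    (hA x).lt_of_isNonArch (isNonArch_of_norm_two_le_one (not_lt.mp hx)) (hRpos x) (hrpos x)
  have htree : ∀ x : V, ¬1 < ‖(2 : x.1.ResidueField)‖ →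
      treeDist (α x) (R x) (β x) (r x) = 2 * Real.log (max ‖α x - β x‖ (max (R x) (r x))) -
        Real.log (R x) - Real.log (r x) := fun x hx =>
    treeDist_eq_of_strictlySeparated (hRpos x) (hrpos x) (hsep x hx)
  have hlim : ∀ x₀ : V, ¬1 < ‖(2 : x₀.1.ResidueField)‖ →
      Tendsto (fun x : V => archModulus (Real.logb 2 ‖(2 : x.1.ResidueField)‖)
        ‖α x - β x‖ (R x) (r x)) (𝓝[arch] x₀)
        (𝓝 (treeDist (α x₀) (R x₀) (β x₀) (r x₀))) := by
    intro x₀ hx₀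
    have hle : 𝓝[arch] x₀ ≤ 𝓝 x₀ := nhdsWithin_le_nhds
    rw [htree x₀ hx₀]
    refine tendsto_archModulus ?_ (hd.continuousAt.tendsto.mono_left hle)
      (hR.continuousAt.tendsto.mono_left hle) (hr.continuousAt.tendsto.mono_left hle)
      (fun x => norm_nonneg _) (hRpos x₀) (hrpos x₀) (hsep x₀ hx₀)
    -- If `‖2‖ = 1` at `x₀`, then `ε = log₂ ‖2‖` tends to `0` from above along Archimedean points.
    -- If `‖2‖ < 1`, there are none near `x₀` and the filter is trivial.
    rcases eq_or_lt_of_le (not_lt.mp hx₀) with h1 | h1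
    · refine tendsto_nhdsWithin_iff.mpr ⟨?_, ?_⟩
      · have hc := (Real.continuousAt_logb (b := 2) (x := ‖(2 : x₀.1.ResidueField)‖)
          (by rw [h1]; exact one_ne_zero)).comp (f := fun x : V => ‖(2 : x.1.ResidueField)‖)
          h2.continuousAt
        have := hc.tendsto.mono_left hle
        simpa only [Function.comp_def, h1, Real.logb_one] using this
      · filter_upwards [self_mem_nhdsWithin] with x hx
        exact Real.logb_pos one_lt_two hx
    · have hbot : 𝓝[arch] x₀ = ⊥ := by
        refine empty_mem_iff_bot.mp ?_
        filter_upwards [self_mem_nhdsWithin,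
          hle (h2.continuousAt.eventually (gt_mem_nhds h1))] with x hx hx'
        exact lt_asymm hx hx'
      rw [hbot]
      exact tendsto_bot
  refine ⟨?_, fun x => annulusModulus_nonneg (hRpos x) (hrpos x) (hA x), ?_⟩
  · rw [continuous_iff_continuousAt]
    intro x₀
    by_cases hx₀ : 1 < ‖(2 : x₀.1.ResidueField)‖
    · have hev : ∀ᶠ x in 𝓝 x₀, 1 < ‖(2 : x.1.ResidueField)‖ :=
        h2.continuousAt.eventually (lt_mem_nhds hx₀)
      refine ContinuousAt.congr (f := fun x : V =>
        archModulus (Real.logb 2 ‖(2 : x.1.ResidueField)‖) ‖α x - β x‖ (R x) (r x)) ?_ ?_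
      · obtain ⟨s⟩ := nonempty_archStructure hx₀
        have hε : ContinuousAt (fun x : V => Real.logb 2 ‖(2 : x.1.ResidueField)‖) x₀ :=
          h2.continuousAt.logb (by linarith)
        have hε0 : 0 < Real.logb 2 ‖(2 : x₀.1.ResidueField)‖ := Real.logb_pos one_lt_two hx₀
        have hεi := hε.inv₀ hε0.ne'
        have cR := hR.continuousAt.rpow hεi (Or.inl (hRpos x₀).ne')
        have cr := hr.continuousAt.rpow hεi (Or.inl (hrpos x₀).ne')
        -- The centres may coincide, so continuity of this power rests on the positive exponent and
        -- not on a nonzero base.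
        have cd := hd.continuousAt.rpow hεi (Or.inr (inv_pos.mpr hε0))
        have hu := s.one_lt_cosh_modulus (hRpos x₀) (hrpos x₀) (hA x₀)
        rw [s.ε_eq] at hu
        refine hε.mul ?_
        refine ContinuousAt.comp (g := Real.arcosh)
          (Real.differentiableAt_arcosh hu).continuousAt ?_
        refine (((cR.pow 2).add (cr.pow 2)).sub (cd.pow 2)).abs.div
          ((cR.const_mul 2).mul cr) ?_
        have := Real.rpow_pos_of_pos (hRpos x₀) (Real.logb 2 ‖(2 : x₀.1.ResidueField)‖)⁻¹
        have := Real.rpow_pos_of_pos (hrpos x₀) (Real.logb 2 ‖(2 : x₀.1.ResidueField)‖)⁻¹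
        positivity
      · filter_upwards [hev] with x hx
        exact (annulusModulus_of_arch hx (hRpos x) (hrpos x) (hA x)).symm
    -- Archimedean and non-Archimedean points near `x₀` are treated separately; both formulas have
    -- the tree distance at `x₀` as limit.
    · rw [ContinuousAt, annulusModulus_of_nonarch hx₀, ← nhdsWithin_univ, ← union_compl_self arch,
        nhdsWithin_union]
      refine Tendsto.sup ?_ ?_
      · refine (hlim x₀ hx₀).congr' ?_
        filter_upwards [self_mem_nhdsWithin] with x hx
        exact (annulusModulus_of_arch hx (hRpos x) (hrpos x) (hA x)).symm
      · rw [htree x₀ hx₀]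
        have hc : Continuous fun x : V => 2 * Real.log (max ‖α x - β x‖ (max (R x) (r x))) -
            Real.log (R x) - Real.log (r x) := by
          refine ((continuous_const.mul ((hd.max (hR.max hr)).log fun x => ?_)).sub
            (hR.log fun x => (hRpos x).ne')).sub (hr.log fun x => (hrpos x).ne')
          exact ((hRpos x).trans_le ((le_max_left _ _).trans (le_max_right _ _))).ne'
        refine (hc.continuousAt.tendsto.mono_left nhdsWithin_le_nhds).congr' ?_
        filter_upwards [self_mem_nhdsWithin] with x hx
        have hx' : ¬1 < ‖(2 : x.1.ResidueField)‖ := hx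
        rw [annulusModulus_of_nonarch hx', htree x hx']
  · intro x₀ hx₀ δ hδ
    have h := Metric.tendsto_nhds.mp
      (hlim x₀ (not_lt.mpr (norm_two_le_one_of_isNonArch hx₀))) δ hδ
    filter_upwards [eventually_nhdsWithin_iff.mp h] with x hx d
    have := hx d.one_lt_norm_two
    rwa [Real.dist_eq, ← d.ε_eq, ← d.modulus_eq (hRpos x) (hrpos x) (hA x)] at this
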